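/- Let $n\ge 1$. Let $D(\mathbb R^n)$ be the space of smooth compactly supported functions (real- or complex-valued) and let $S'_e$ be the set of distributions $f\in D'(\mathbb R^n)$ for which there are $C_f,N_f$ with $|\langle f,\psi\rangle|\le C_f\sup\{|D^\beta\psi(x)|e^{N_f|x|}:x\in\mathbb R^n,\ |\beta|\le N_f\}$ for all $\psi\in D(\mathbb R^n)$. Fix $\varphi_0\in D(\mathbb R^n)$ with $\int\varphi_0\,dx=1$, and put $\varphi:=\varphi_0-2^{-n}\varphi_0(\cdot/2)$ and $\varphi_k:=2^{kn}\varphi(2^k\,\cdot)$ for $k\ge1$ (while $\varphi_0$ itself is the term with index $k=0$). For $k\in\mathbb N_0$, $m\in\mathbb Z^n$ let $Q_{k,m}:=\prod_{i=1}^n\bigl(\tfrac{m_i}{2^k},\tfrac{m_i+1}{2^k}\bigr)$. For $0<\mu\le s\le\infty$ put $s_\mu:=s/\mu$ (with $s_\mu:=1$ if $\mu=s$, also when $s=\infty$) and let $s'_\mu\in[1,\infty]$ be the Hölder conjugate of $s_\mu$: $\frac1{s_\mu}+\frac1{s'_\mu}=1$. Let $p,\sigma_1,\sigma_2\in(0,\infty]$,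 $\alpha_3\ge0$, $\sigma=(\sigma_1,\sigma_2)$, and let $\alpha=(\alpha^1,\alpha^2)$, where $\alpha^1=\{\alpha^1_k\}_{k\ge0}$, $\alpha^2=\{\alpha^2_k\}_{k\ge0}$ are sequences of positive reals. A sequence $\{t_k\}_{k\ge0}$ of measurable functions on $\mathbb R^n$, positive almost everywhere, with $t_k\in L_p^{loc}(\mathbb R^n)$ for all $k$, belongs to $X^{\alpha_3}_{\alpha,\sigma,p}$ if there are $C_1,C_2>0$ such that for all $0\le k\le j$ and $m\in\mathbb Z^n$ (with essential suprema in place of the means for infinite exponents) $$\Bigl(2^{kn}\!\int_{Q_{k,m}}\!t_k^p\Bigr)^{1/p}\Bigl(2^{kn}\!\int_{Q_{k,m}}\!t_j^{-\sigma_1}\Bigr)^{1/\sigma_1}\le C_1\frac{\alpha^1_k}{\alpha^1_j},\qquad \Bigl(2^{kn}\!\int_{Q_{k,m}}\!t_k^p\Bigr)^{-1/p}\Bigl(2^{kn}\!\int_{Q_{k,m}}\!t_j^{\sigma_2}\Bigr)^{1/\sigma_2}\le C_2\frac{\alpha^2_j}{\alpha^2_k},$$ and $0<\|t_k|L_p(Q_{k,m})\|\le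 2^{\alpha_3}\|t_k|L_p(Q_{k,\widetilde m})\|$ for all $k\in\mathbb N_0$ and all $m,\widetilde m\in\mathbb Z^n$ with $|m_i-\widetilde m_i|\le1$, $i=1,\dots,n$. For such $\{t_k\}$ and $q\in(0,\infty]$, $B^{\varphi_0}_{p,q}(\mathbb R^n,\{t_k\})$ is the set of all $f\in S'_e$ with $$\Bigl(\sum_{k=0}^\infty\|t_k(\varphi_k*f)|L_p(\mathbb R^n)\|^q\Bigr)^{1/q}<\infty$$ (the supremum over $k$ if $q=\infty$). **Theorem 4.1.** Let $p,q\in(0,\infty]$, $r\in[1,\infty]$, $\theta\in(0,\min\{p,r\}]$, $\sigma_1=\theta p'_\theta$ (so that $\frac1{\sigma_1}=\frac1\theta-\frac1p$), $\sigma_2\in(0,\infty]$, $\alpha_3\ge0$. Assume that the sequence $\bigl\{2^{kn\mu(\frac1\theta-\frac1r)}(\alpha^1_k)^{-\mu}\bigr\}_{k\ge0}$ lies in $l_{q'_\mu}$ for some real $\mu$ with $0<\mu\le\min\{1,q,\theta\}$, and let $\{t_k\}\in X^{\alpha_3}_{\alpha,\sigma,p}$. Then $B^{\varphi_0}_{p,q}(\mathbb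 R^n,\{t_k\})\subset L_r^{loc}(\mathbb R^n)$; that is, for every $f\in B^{\varphi_0}_{p,q}(\mathbb R^n,\{t_k\})$ there is $g\in L_r^{loc}(\mathbb R^n)$ with $\langle f,\psi\rangle=\int g\psi\,dx$ for all $\psi\in D(\mathbb R^n)$. -/

import Mathlib

open MeasureTheory TopologicalSpace
open scoped ENNReal Distributions

noncomputable section

namespace VarBesov

/-- Euclidean space `ℝⁿ`. -/
abbrev Rn (n : ℕ) : Type := EuclideanSpace ℝ (Fin n)

/-- The space `D(ℝⁿ)` of smooth compactly supported `𝕜`-valued functions (`𝕜 = ℝ` or `ℂ`). -/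
abbrev Test (𝕜 : Type*) [RCLike 𝕜] (n : ℕ) : Type _ := 𝓓((⊤ : Opens (Rn n)), 𝕜)

/-- The space `D'(ℝⁿ)` of continuous linear functionals on `D(ℝⁿ)`. -/
abbrev Distr (𝕜 : Type*) [RCLike 𝕜] (n : ℕ) : Type _ := Test 𝕜 n →L[𝕜] 𝕜

section Distributions

variable {𝕜 : Type*} [RCLike 𝕜] {n : ℕ}

/-- The distributions `f` of at most exponential growth: for some `C` and `N`,
`|⟨f, ψ⟩| ≤ C * sup {|D^β ψ (x)| * exp (N * |x|) : x ∈ ℝⁿ, |β| ≤ N}` for all `ψ ∈ D(ℝⁿ)`.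
The supremum is finite (`ψ` has compact support), and is written through its upper bounds `B`;
the partial derivatives of order `i` are collected in the `i`-th Fréchet derivative. -/
def IsExpDistr (f : Distr 𝕜 n) : Prop :=
  ∃ (C : ℝ) (N : ℕ), ∀ (ψ : Test 𝕜 n) (B : ℝ),
    (∀ i ≤ N, ∀ x : Rn n, ‖iteratedFDeriv ℝ i ψ x‖ * Real.exp (N * ‖x‖) ≤ B) →
      ‖f ψ‖ ≤ C * B

/-- The test function `g ∘ e` for a smooth homeomorphism `e` of `ℝⁿ`. -/
def Test.compHomeo (g : Test 𝕜 n) (e : Rn n ≃ₜ Rn n) (he : ContDiff ℝ (⊤ : ℕ∞) e) :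
    Test 𝕜 n where
  toFun x := g (e x)
  contDiff' := g.contDiff.comp he
  hasCompactSupport' := g.hasCompactSupport.comp_homeomorph e
  tsupport_subset' := fun _ _ => trivial

/-- The test function `x ↦ g (c x)`, `c ≠ 0`. -/
def Test.scale (c : ℝ) (hc : c ≠ 0) (g : Test 𝕜 n) : Test 𝕜 n :=
  Test.compHomeo g (Homeomorph.smulOfNeZero c hc) (contDiff_const_smul c)

/-- The test function `y ↦ g (x - y)`. -/
def Test.reflect (x : Rn n) (g : Test 𝕜 n) : Test 𝕜 n :=
  Test.compHomeo g (Homeomorph.subLeft x) (contDiff_const.sub contDiff_id)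

theorem Test.scale_apply (c : ℝ) (hc : c ≠ 0) (g : Test 𝕜 n) (x : Rn n) :
    Test.scale c hc g x = g (c • x) := rfl

theorem Test.reflect_apply (x : Rn n) (g : Test 𝕜 n) (y : Rn n) :
    Test.reflect x g y = g (x - y) := rfl

/-- `g_j (x) = 2^{jn} g (2^j x)`. -/
def Test.dyadic (j : ℕ) (g : Test 𝕜 n) : Test 𝕜 n :=
  ((2 : 𝕜) ^ (j * n)) • Test.scale ((2 : ℝ) ^ j) (by positivity) g

/-- `φ = φ₀ - 2^{-n} φ₀ (· / 2)`. -/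
def phi (φ₀ : Test 𝕜 n) : Test 𝕜 n :=
  φ₀ - ((2 : 𝕜) ^ n)⁻¹ • Test.scale (1 / 2 : ℝ) (by norm_num) φ₀

/-- The sequence `φ₀, φ₁, φ₂, …`, where `φ_k (x) = 2^{kn} φ (2^k x)` for `k ≥ 1`. -/
def phiSeq (φ₀ : Test 𝕜 n) : ℕ → Test 𝕜 n
  | 0 => φ₀
  | k + 1 => Test.dyadic (k + 1) (phi φ₀)

/-- The convolution `g * f` of a test function and a distribution, a function on `ℝⁿ`:
`(g * f) (x) = ⟨f, g (x - ·)⟩`. -/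
def conv (g : Test 𝕜 n) (f : Distr 𝕜 n) (x : Rn n) : 𝕜 := f (Test.reflect x g)

/-- The quasi-norm of a sequence of elements of `[0, ∞]` in `l_q`. -/
def lqNorm (q : ℝ≥0∞) (a : ℕ → ℝ≥0∞) : ℝ≥0∞ :=
  if q = ∞ then ⨆ k, a k else (∑' k, a k ^ q.toReal) ^ (1 / q.toReal)

/-- The quasi-norm `(∑ₖ ‖t_k (φ_k * f) | L_p(ℝⁿ)‖^q)^{1/q}`. -/
def besovNorm (φ₀ : Test 𝕜 n) (p q : ℝ≥0∞) (t : ℕ → Rn n → ℝ) (f : Distr 𝕜 n) : ℝ≥0∞ :=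
  lqNorm q fun k => eLpNorm (fun x => t k x • conv (phiSeq φ₀ k) f x) p volume

/-- The Besov space of variable smoothness `B^{φ₀}_{p,q}(ℝⁿ, {t_k})`. -/
def besovSpace (φ₀ : Test 𝕜 n) (p q : ℝ≥0∞) (t : ℕ → Rn n → ℝ) : Set (Distr 𝕜 n) :=
  {f | IsExpDistr f ∧ besovNorm φ₀ p q t f < ∞}

/-- `g ∈ L_r^loc(ℝⁿ)`, for a function `g`. -/
def MemLpLoc {F : Type*} [NormedAddCommGroup F] (g : Rn n → F) (r : ℝ≥0∞) : Prop :=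
  ∀ K : Set (Rn n), IsCompact K → MemLp g r (volume.restrict K)

/-- The distributions that are functions of `L_r^loc(ℝⁿ)`, for `r ≥ 1`. -/
def lpLocDistr (𝕜 : Type*) [RCLike 𝕜] (n : ℕ) (r : ℝ≥0∞) : Set (Distr 𝕜 n) :=
  {f | ∃ g : Rn n → 𝕜, MemLpLoc g r ∧ ∀ ψ : Test 𝕜 n, f ψ = ∫ x, g x * ψ x}

end Distributions

section Weights

variable {n : ℕ}

/-- The open dyadic cube `Q_{k,m} = ∏ᵢ (mᵢ / 2^k, (mᵢ + 1) / 2^k)`. -/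
def dyadicCube (k : ℕ) (m : Fin n → ℤ) : Set (Rn n) :=
  {x | ∀ i, (m i : ℝ) / 2 ^ k < x i ∧ x i < ((m i : ℝ) + 1) / 2 ^ k}

/-- `(2^{kn} ∫_{Q_{k,m}} |g|^s)^{1/s}`, and the essential supremum of `|g|` over `Q_{k,m}`
for `s = ∞`. -/
def cubeMean (g : Rn n → ℝ) (s : ℝ≥0∞) (k : ℕ) (m : Fin n → ℤ) : ℝ≥0∞ :=
  eLpNorm g s ((2 : ℝ≥0∞) ^ (k * n) • volume.restrict (dyadicCube k m))

/-- `t_{k,m} = ‖t_k | L_p(Q_{k,m})‖`. -/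
def cubeNorm (t : ℕ → Rn n → ℝ) (p : ℝ≥0∞) (k : ℕ) (m : Fin n → ℤ) : ℝ≥0∞ :=
  eLpNorm (t k) p (volume.restrict (dyadicCube k m))

/-- `{t_k}` is a `p`-admissible weight sequence: the `t_k` are measurable, positive almost
everywhere, and lie in `L_p^loc(ℝⁿ)`. -/
structure IsAdmissible (p : ℝ≥0∞) (t : ℕ → Rn n → ℝ) : Prop where
  aemeasurable : ∀ k, AEMeasurable (t k) volume
  pos : ∀ k, ∀ᵐ x ∂(volume : Measure (Rn n)), 0 < t k x
  memLpLoc : ∀ k, MemLpLoc (t k) p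

/-- The weight class `X^{α₃}_{α,σ,p}`, with `α = (α₁, α₂)` and `σ = (σ₁, σ₂)`. -/
structure IsXClass (p σ₁ σ₂ : ℝ≥0∞) (α₁ α₂ : ℕ → ℝ) (α₃ : ℝ) (t : ℕ → Rn n → ℝ) : Prop where
  admissible : IsAdmissible p t
  lower : ∃ C₁ : ℝ, 0 < C₁ ∧ ∀ k j : ℕ, k ≤ j → ∀ m : Fin n → ℤ,
    cubeMean (t k) p k m * cubeMean (fun x => (t j x)⁻¹) σ₁ k m
      ≤ ENNReal.ofReal (C₁ * (α₁ k / α₁ j))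
  upper : ∃ C₂ : ℝ, 0 < C₂ ∧ ∀ k j : ℕ, k ≤ j → ∀ m : Fin n → ℤ,
    (cubeMean (t k) p k m)⁻¹ * cubeMean (t j) σ₂ k m
      ≤ ENNReal.ofReal (C₂ * (α₂ j / α₂ k))
  neighbour : ∀ (k : ℕ) (m m' : Fin n → ℤ), (∀ i, |m i - m' i| ≤ 1) →
    0 < cubeNorm t p k m ∧
      cubeNorm t p k m ≤ ENNReal.ofReal ((2 : ℝ) ^ α₃) * cubeNorm t p k m'

end Weights

/-- The quotient `s_μ = s / μ` for `0 < μ ≤ s ≤ ∞`, where `s_s = 1` also for `s = ∞`. -/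
def expQuot (s μ : ℝ≥0∞) : ℝ≥0∞ := if s = μ then 1 else s / μ

/-- The Hölder conjugate `s'_μ` of `s_μ = s / μ`. -/
def expQuotConj (s μ : ℝ≥0∞) : ℝ≥0∞ := ENNReal.conjExponent (expQuot s μ)

end VarBesov

end

/-! Write Φ_j for 2^{jn} φ₀(2^j ·). Since φ_0 + … + φ_K = Φ_K and Φ_K * f → f in D', it suffices
that Σ_k ‖φ_k * f‖ in L_r(K) is finite for every compact K: the series then converges to a function
in L_r^loc, and this function is f (`IsExpDistr.mem_lpLocDistr`).

The main obstacle is that the weights give only L_θ information, where θ may be below 1 and below r,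
and that φ_0 has compact support, so the usual Fourier-side Nikol'skii inequality is not at hand. It
is replaced by a local reproducing formula. Let E_j be the operator g ↦ g - Φ_j * g. The operators
E_j commute and E_j - E_{j+1} is convolution with φ_{j+1}, so factoring E_j^{L+1} - E_{j+1}^{L+1}
and telescoping expresses φ_k as Σ_d kern_{k,d} * φ_{k+d} plus a remainder that vanishes against f.
Because ∫ φ₀ = 1, every factor E_j gains 2^{-j} at the price of one derivative; hence kern_{k,d}
lives in a ball of radius about 2^{-k} and is at most a constant times 2^{kn} 2^{-dL}
(`phiSeq_eq_sum_cv_kern`, `exists_norm_kern_le`). Here L is arbitrary and no moment of φ_0 has to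
vanish.

Consequently |φ_k * f| is dominated by Σ_d 2^{-dL} times the means of |φ_{k+d} * f| over balls of
radius about 2^{-k}, also after multiplication by exp(-R|x|) (`IsExpDistr.exists_wconv_le_tsum`).
Exponential growth of f makes the weighted suprema X_j finite, with X_j ≤ C 2^{jA}. Bounding a mean
by X^{1-s} times a power s = min(1, θ) of an L_θ norm, and absorbing the X with L ≥ A, bounds X_k by
the L_θ norms of the later terms alone; interpolation between L_θ and L_∞ then reaches L_r with the
factor 2^{jn(1/θ-1/r)} (`IsExpDistr.exists_eLpNorm_wconv_le`). The constants may depend on f, which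
is harmless for an inclusion of sets.

On unit cubes, Hölder with 1/θ = 1/σ₁ + 1/p and the first condition of the weight class for k = 0
bound the L_θ norm of φ_j * f by ‖t_j (φ_j * f)‖_p / α¹_j, up to the inverse of ‖t_0‖ in L_p of the
cube. The neighbour condition lets that inverse grow at most exponentially, which the weight
exp(-R|x|) pays for (`IsXClass.exists_eLpNorm_le`).

What remains is Σ_j w_j a_j < ∞ with w_j = 2^{jn(1/θ-1/r)} / α¹_j and a_j = ‖t_j (φ_j * f)‖_p.
Hölder for a^μ and w^μ gives Σ (w_j a_j)^μ < ∞, and μ ≤ 1 finishes. -/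

noncomputable section

namespace VarBesov

/-! ### Convolution operators on test functions and the local reproducing formula -/

section TestFunctions

open scoped Convolution ContDiff

variable {𝕜 : Type*} [RCLike 𝕜] {n : ℕ}

/-- The convolution of two test functions. -/
def Test.cv (h g : Test 𝕜 n) : Test 𝕜 n where
  toFun := (h : Rn n → 𝕜) ⋆[ContinuousLinearMap.mul ℝ 𝕜, volume] (g : Rn n → 𝕜)
  contDiff' := g.hasCompactSupport.contDiff_convolution_right _
    h.continuous.locallyIntegrable g.contDiff
  hasCompactSupport' := h.hasCompactSupport.convolution _ g.hasCompactSupport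
  tsupport_subset' := fun _ _ => trivial

theorem Test.cv_apply (h g : Test 𝕜 n) (x : Rn n) :
    Test.cv h g x = ∫ y, h y * g (x - y) := rfl

theorem Test.integrable (g : Test 𝕜 n) : Integrable g (volume : Measure (Rn n)) :=
  g.continuous.integrable_of_hasCompactSupport g.hasCompactSupport

theorem Test.integrable_mul_comp_sub (h g : Test 𝕜 n) (x : Rn n) :
    Integrable (fun y => h y * g (x - y)) (volume : Measure (Rn n)) := by
  refine Continuous.integrable_of_hasCompactSupport (by fun_prop) ?_
  exact HasCompactSupport.mul_right h.hasCompactSupport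

theorem Test.cv_comm (h g : Test 𝕜 n) : Test.cv h g = Test.cv g h := by
  ext x
  rw [Test.cv_apply, Test.cv_apply, ← integral_sub_left_eq_self _ volume x]
  refine integral_congr_ae (Filter.Eventually.of_forall fun y => ?_)
  simp [mul_comm]

theorem Test.cv_assoc (h g k : Test 𝕜 n) :
    Test.cv (Test.cv h g) k = Test.cv h (Test.cv g k) := by
  ext x
  refine convolution_assoc (f := (h : Rn n → 𝕜)) (g := (g : Rn n → 𝕜)) (k := (k : Rn n → 𝕜))
    (L := ContinuousLinearMap.mul ℝ 𝕜) (L₂ := ContinuousLinearMap.mul ℝ 𝕜)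
    (L₃ := ContinuousLinearMap.mul ℝ 𝕜) (L₄ := ContinuousLinearMap.mul ℝ 𝕜)
    (fun a b c => by simp [mul_assoc]) ?_ ?_ ?_ ?_ ?_ ?_
  · exact h.continuous.aestronglyMeasurable
  · exact g.continuous.aestronglyMeasurable
  · exact k.continuous.aestronglyMeasurable
  · refine Filter.Eventually.of_forall fun y => ?_
    exact HasCompactSupport.convolutionExists_right _ g.hasCompactSupport
      h.continuous.locallyIntegrable g.continuous y
  · refine Filter.Eventually.of_forall fun y => ?_
    exact HasCompactSupport.convolutionExists_right _ k.hasCompactSupport.norm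
      g.continuous.norm.locallyIntegrable k.continuous.norm y
  · refine HasCompactSupport.convolutionExists_right _ ?_ ?_ ?_ x
    · exact HasCompactSupport.convolution _ g.hasCompactSupport.norm k.hasCompactSupport.norm
    · exact h.continuous.norm.locallyIntegrable
    · exact HasCompactSupport.continuous_convolution_right _ k.hasCompactSupport.norm
        g.continuous.norm.locallyIntegrable k.continuous.norm

/-- Convolution of test functions as a linear map into the operators on test functions. -/
def Test.cvL : Test 𝕜 n →ₗ[𝕜] Module.End 𝕜 (Test 𝕜 n) :=
  LinearMap.mk₂ 𝕜 Test.cv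
    (fun a b c => by
      ext x
      simp only [Test.cv_apply, add_apply, add_mul]
      exact integral_add (a.integrable_mul_comp_sub c x) (b.integrable_mul_comp_sub c x))
    (fun a b c => by
      ext x
      simp only [Test.cv_apply, smul_apply, smul_eq_mul, mul_assoc]
      exact integral_const_mul _ _)
    (fun a b c => by
      ext x
      simp only [Test.cv_apply, add_apply, mul_add]
      exact integral_add (a.integrable_mul_comp_sub b x) (a.integrable_mul_comp_sub c x))
    (fun a b c => by
      ext x
      simp only [Test.cv_apply, smul_apply, smul_eq_mul, mul_left_comm _ a]
      exact integral_const_mul _ _)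

theorem Test.cvL_apply (h g : Test 𝕜 n) : Test.cvL h g = Test.cv h g := rfl

/-- Test functions have no unit for convolution. As operators they sit in a ring with one, where
geometric sums in 1 - Φ_j make sense. -/
theorem Test.cvL_cv (h g : Test 𝕜 n) : Test.cvL (Test.cv h g) = Test.cvL h * Test.cvL g := by
  ext1 k
  exact Test.cv_assoc h g k

theorem Test.commute_cvL (h g : Test 𝕜 n) : Commute (Test.cvL h) (Test.cvL g) := by
  rw [Commute, SemiconjBy, ← Test.cvL_cv, ← Test.cvL_cv, Test.cv_comm]

/-- The operator `g ↦ g - h * g`. -/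
def Test.errL (h : Test 𝕜 n) : Module.End 𝕜 (Test 𝕜 n) := 1 - Test.cvL h

theorem Test.errL_apply (h g : Test 𝕜 n) : Test.errL h g = g - Test.cv h g := rfl

theorem Test.commute_errL (h g : Test 𝕜 n) : Commute (Test.errL h) (Test.errL g) :=
  ((Commute.one_left _).sub_left ((Commute.one_right _).sub_right (Test.commute_cvL h g)))

theorem Test.cvL_errL_pow (h g : Test 𝕜 n) (i : ℕ) :
    Test.cvL ((Test.errL h ^ i) g) = Test.errL h ^ i * Test.cvL g := by
  induction i with
  | zero => simp
  | succ i ih =>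
    rw [pow_succ', Module.End.mul_apply, Test.errL_apply, map_sub, Test.cvL_cv, ih, mul_assoc,
      Test.errL, sub_mul, one_mul]

/-- The supremum of the norm of the `i`-th derivative. -/
def Test.pnorm (i : ℕ) (g : Test 𝕜 n) : ℝ := ⨆ x, ‖iteratedFDeriv ℝ i g x‖

theorem Test.bddAbove_norm_iteratedFDeriv (i : ℕ) (g : Test 𝕜 n) :
    BddAbove (Set.range fun x => ‖iteratedFDeriv ℝ i g x‖) := by
  have hc : Continuous (iteratedFDeriv ℝ i g) :=
    g.contDiff.continuous_iteratedFDeriv (by exact_mod_cast le_top)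
  obtain ⟨C, hC⟩ := hc.bounded_above_of_compact_support (g.hasCompactSupport.iteratedFDeriv i)
  exact ⟨C, by rintro _ ⟨x, rfl⟩; exact hC x⟩

theorem Test.norm_iteratedFDeriv_le_pnorm (i : ℕ) (g : Test 𝕜 n) (x : Rn n) :
    ‖iteratedFDeriv ℝ i g x‖ ≤ g.pnorm i :=
  le_ciSup (g.bddAbove_norm_iteratedFDeriv i) x

theorem Test.pnorm_le {i : ℕ} {g : Test 𝕜 n} {B : ℝ}
    (h : ∀ x, ‖iteratedFDeriv ℝ i g x‖ ≤ B) : g.pnorm i ≤ B := ciSup_le h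

theorem Test.pnorm_nonneg (i : ℕ) (g : Test 𝕜 n) : 0 ≤ g.pnorm i :=
  (norm_nonneg _).trans (g.norm_iteratedFDeriv_le_pnorm i 0)

theorem Test.norm_le_pnorm (g : Test 𝕜 n) (x : Rn n) : ‖g x‖ ≤ g.pnorm 0 := by
  simpa using g.norm_iteratedFDeriv_le_pnorm 0 x

theorem Test.pnorm_add_le (i : ℕ) (g h : Test 𝕜 n) : (g + h).pnorm i ≤ g.pnorm i + h.pnorm i := by
  refine Test.pnorm_le fun x => ?_
  have hg : ContDiff ℝ i g := g.contDiff.of_le (by exact_mod_cast le_top)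
  have hh : ContDiff ℝ i h := h.contDiff.of_le (by exact_mod_cast le_top)
  have : iteratedFDeriv ℝ i (g + h : Test 𝕜 n) x
      = iteratedFDeriv ℝ i g x + iteratedFDeriv ℝ i h x := by
    rw [FunLike.coe_add, iteratedFDeriv_add_apply hg.contDiffAt hh.contDiffAt]
  rw [this]
  exact (norm_add_le _ _).trans
    (add_le_add (g.norm_iteratedFDeriv_le_pnorm i x) (h.norm_iteratedFDeriv_le_pnorm i x))

theorem Test.pnorm_zero (i : ℕ) : (0 : Test 𝕜 n).pnorm i = 0 := by
  refine le_antisymm (Test.pnorm_le fun x => ?_) (Test.pnorm_nonneg i 0)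
  rw [FunLike.coe_zero, iteratedFDeriv_zero]; simp

theorem Test.pnorm_sum_le {ι : Type*} (s : Finset ι) (i : ℕ) (g : ι → Test 𝕜 n) :
    (∑ a ∈ s, g a).pnorm i ≤ ∑ a ∈ s, (g a).pnorm i :=
  Finset.le_sum_of_subadditive _ (Test.pnorm_zero i).le (Test.pnorm_add_le i) _ _

/-- The mean value inequality, carried through derivatives under the integral sign. The target `F`
is general because the induction replaces g by its derivative. It serves twice: with the shifts 0
and y for E_j, and with the shifts y and s(y), s a simple function, for Riemann sums. -/
theorem norm_iteratedFDeriv_integral_smul_sub_le {F : Type*} [NormedAddCommGroup F]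
    [NormedSpace ℝ F] [NormedSpace 𝕜 F] [SMulCommClass ℝ 𝕜 F] {b : Rn n → 𝕜} (hb : Integrable b)
    {τ τ' : Rn n → Rn n} (hτ : Measurable τ) (hτ' : Measurable τ') {ε : ℝ}
    (hε : ∀ y, b y ≠ 0 → ‖τ y - τ' y‖ ≤ ε) (i : ℕ) {g : Rn n → F} (hg : ContDiff ℝ ∞ g)
    (hgc : HasCompactSupport g) {B : ℝ} (hB : ∀ x, ‖iteratedFDeriv ℝ (i + 1) g x‖ ≤ B)
    (x : Rn n) :
    ‖iteratedFDeriv ℝ i (fun x => ∫ y, b y • (g (x - τ y) - g (x - τ' y))) x‖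
      ≤ (∫ y, ‖b y‖) * ε * B := by
  induction i generalizing F with
  | zero =>
    rw [norm_iteratedFDeriv_zero]
    have hlip : ∀ u v, ‖g u - g v‖ ≤ B * ‖u - v‖ := fun u v =>
      Convex.norm_image_sub_le_of_norm_fderiv_le (s := Set.univ)
        (fun z _ => (hg.differentiable (by simp)).differentiableAt)
        (fun z _ => by simpa using hB z) convex_univ trivial trivial
    have hB0 : 0 ≤ B := (norm_nonneg _).trans (hB 0)
    rw [mul_assoc, ← integral_mul_const]
    refine norm_integral_le_of_norm_le (hb.norm.mul_const _) (Filter.Eventually.of_forall fun y => ?_)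
    rw [norm_smul]
    by_cases hy : b y = 0
    · simp [hy]
    · refine mul_le_mul_of_nonneg_left ?_ (norm_nonneg _)
      refine (hlip _ _).trans ?_
      rw [mul_comm ε]
      refine mul_le_mul_of_nonneg_left ?_ hB0
      rw [sub_sub_sub_cancel_left, norm_sub_rev]
      exact hε y hy
  | succ i ih =>
    have hg' : ContDiff ℝ ∞ (fderiv ℝ g) := hg.fderiv_right (by simp)
    obtain ⟨C, hC⟩ := hg.continuous.bounded_above_of_compact_support hgc
    obtain ⟨C', hC'⟩ := hg'.continuous.bounded_above_of_compact_support (hgc.fderiv ℝ)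
    have hd : ∀ x, HasFDerivAt (fun x => ∫ y, b y • (g (x - τ y) - g (x - τ' y)))
        (∫ y, b y • (fderiv ℝ g (x - τ y) - fderiv ℝ g (x - τ' y))) x := by
      intro x
      have hm : ∀ x, AEStronglyMeasurable (fun y => b y • (g (x - τ y) - g (x - τ' y)))
          (volume : Measure (Rn n)) := fun x =>
        hb.aestronglyMeasurable.smul
          ((hg.continuous.comp_aestronglyMeasurable
            (by exact (measurable_const.sub hτ).aestronglyMeasurable)).sub
          (hg.continuous.comp_aestronglyMeasurable
            (by exact (measurable_const.sub hτ').aestronglyMeasurable)))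
      refine hasFDerivAt_integral_of_dominated_of_fderiv_le (𝕜 := ℝ) (s := Set.univ)
        (F := fun x y => b y • (g (x - τ y) - g (x - τ' y)))
        (F' := fun x y => b y • (fderiv ℝ g (x - τ y) - fderiv ℝ g (x - τ' y)))
        (bound := fun y => ‖b y‖ * (C' + C')) Filter.univ_mem
        (Filter.Eventually.of_forall hm) ?_ ?_ ?_ (hb.norm.mul_const _) ?_
      · refine (hb.norm.mul_const (C + C)).mono' (hm x) (Filter.Eventually.of_forall fun y => ?_)
        rw [norm_smul]
        exact mul_le_mul_of_nonneg_left ((norm_sub_le _ _).trans (add_le_add (hC _) (hC _)))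
          (norm_nonneg _)
      · exact hb.aestronglyMeasurable.smul
          ((hg'.continuous.comp_aestronglyMeasurable
            (by exact (measurable_const.sub hτ).aestronglyMeasurable)).sub
          (hg'.continuous.comp_aestronglyMeasurable
            (by exact (measurable_const.sub hτ').aestronglyMeasurable)))
      · refine Filter.Eventually.of_forall fun y z _ => ?_
        rw [norm_smul]
        exact mul_le_mul_of_nonneg_left ((norm_sub_le _ _).trans (add_le_add (hC' _) (hC' _)))
          (norm_nonneg _)
      · refine Filter.Eventually.of_forall fun y z _ => ?_
        have h1 : ∀ v, HasFDerivAt (fun x => g (x - v)) (fderiv ℝ g (z - v)) z := fun v =>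
          (hasFDerivAt_comp_sub v).2 ((hg.differentiable (by simp)) (z - v)).hasFDerivAt
        exact ((h1 _).sub (h1 _)).const_smul (b y)
    have hfd : fderiv ℝ (fun x => ∫ y, b y • (g (x - τ y) - g (x - τ' y)))
        = fun x => ∫ y, b y • (fderiv ℝ g (x - τ y) - fderiv ℝ g (x - τ' y)) :=
      funext fun x => (hd x).fderiv
    rw [← norm_iteratedFDeriv_fderiv, hfd]
    exact ih hg' (hgc.fderiv ℝ) fun x => by rw [norm_iteratedFDeriv_fderiv]; exact hB x

/-- `g` vanishes outside of the closed ball of radius `ρ` around the origin. -/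
def Test.SuppIn (ρ : ℝ) (g : Test 𝕜 n) : Prop := ∀ x, ρ < ‖x‖ → g x = 0

theorem Test.SuppIn.mono {ρ ρ' : ℝ} {g : Test 𝕜 n} (h : g.SuppIn ρ) (hρ : ρ ≤ ρ') :
    g.SuppIn ρ' := fun x hx => h x (hρ.trans_lt hx)

theorem Test.SuppIn.sub {ρ : ℝ} {g h : Test 𝕜 n} (hg : g.SuppIn ρ) (hh : h.SuppIn ρ) :
    (g - h).SuppIn ρ := fun x hx => by simp [hg x hx, hh x hx]

theorem Test.SuppIn.sum {ι : Type*} {s : Finset ι} {ρ : ℝ} {g : ι → Test 𝕜 n}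
    (hg : ∀ a ∈ s, (g a).SuppIn ρ) : (∑ a ∈ s, g a).SuppIn ρ := by
  classical
  induction s using Finset.induction_on with
  | empty => intro x _; simp
  | insert a s ha ih =>
    intro x hx
    rw [Finset.sum_insert ha, add_apply, hg a (by simp) x hx,
      ih (fun b hb => hg b (by simp [hb])) x hx, add_zero]

theorem Test.exists_suppIn (g : Test 𝕜 n) : ∃ ρ, 0 < ρ ∧ g.SuppIn ρ := by
  obtain ⟨ρ, hρ, h⟩ := g.hasCompactSupport.isCompact.isBounded.subset_closedBall_lt 0 0
  refine ⟨ρ, hρ, fun x hx => ?_⟩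
  by_contra hne
  have := h (subset_tsupport _ hne)
  rw [mem_closedBall_zero_iff] at this
  linarith

theorem Test.SuppIn.cv {ρ ρ' : ℝ} {h g : Test 𝕜 n} (hh : h.SuppIn ρ) (hg : g.SuppIn ρ') :
    (Test.cv h g).SuppIn (ρ + ρ') := by
  intro x hx
  rw [Test.cv_apply]
  refine integral_eq_zero_of_ae (Filter.Eventually.of_forall fun y => ?_)
  by_cases hy : ρ < ‖y‖
  · simp [hh y hy]
  · have : ρ' < ‖x - y‖ := by have := norm_sub_norm_le x y; linarith
    simp [hg _ this]

theorem Test.SuppIn.errL {ρ ρ' : ℝ} {h g : Test 𝕜 n} (hρ : 0 ≤ ρ) (hh : h.SuppIn ρ)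
    (hg : g.SuppIn ρ') : (Test.errL h g).SuppIn (ρ + ρ') := by
  rw [Test.errL_apply]
  exact (hg.mono (by linarith)).sub (hh.cv hg)

theorem Test.SuppIn.errL_pow {ρ ρ' : ℝ} {h g : Test 𝕜 n} (hρ : 0 ≤ ρ) (hh : h.SuppIn ρ)
    (hg : g.SuppIn ρ') (i : ℕ) : ((Test.errL h ^ i) g).SuppIn (i * ρ + ρ') := by
  induction i with
  | zero => simpa using hg
  | succ i ih =>
    rw [pow_succ', Module.End.mul_apply]
    refine (Test.SuppIn.errL hρ hh ih).mono ?_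
    push_cast; linarith

/-- As ∫ h = 1, g - h * g is the average of g(x) - g(x - y) against h(y), with |y| ≤ ρ. This is the
gain of ρ for one derivative. -/
theorem Test.pnorm_errL_le {ρ : ℝ} {h : Test 𝕜 n} (hh : h.SuppIn ρ) (h1 : ∫ x, h x = 1)
    (i : ℕ) (g : Test 𝕜 n) :
    (Test.errL h g).pnorm i ≤ (∫ y, ‖h y‖) * ρ * g.pnorm (i + 1) := by
  refine Test.pnorm_le fun x => ?_
  have he : (Test.errL h g : Rn n → 𝕜)
      = fun x => ∫ y, h y • (g (x - (fun _ => 0 : Rn n → Rn n) y) - g (x - id y)) := by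
    funext x
    simp only [Test.errL_apply, sub_apply, Test.cv_apply, smul_eq_mul, mul_sub, sub_zero,
      id]
    rw [integral_sub (h.integrable.mul_const _) (h.integrable_mul_comp_sub g x),
      integral_mul_const, h1, one_mul]
  rw [he]
  refine norm_iteratedFDeriv_integral_smul_sub_le h.integrable measurable_const measurable_id
    (fun y hy => ?_) i g.contDiff g.hasCompactSupport (g.norm_iteratedFDeriv_le_pnorm (i + 1)) x
  by_contra hlt
  exact hy (hh y (by simpa using hlt))

theorem Test.pnorm_errL_pow_le {ρ : ℝ} {h : Test 𝕜 n} (hρ : 0 ≤ ρ) (hh : h.SuppIn ρ)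
    (h1 : ∫ x, h x = 1) (i m : ℕ) (g : Test 𝕜 n) :
    ((Test.errL h ^ m) g).pnorm i ≤ ((∫ y, ‖h y‖) * ρ) ^ m * g.pnorm (i + m) := by
  induction m generalizing i with
  | zero => simp
  | succ m ih =>
    rw [pow_succ', Module.End.mul_apply]
    refine (Test.pnorm_errL_le hh h1 i _).trans ?_
    rw [pow_succ', mul_assoc _ (_ ^ m)]
    refine mul_le_mul_of_nonneg_left ?_ (mul_nonneg (integral_nonneg fun _ => norm_nonneg _) hρ)
    have := ih (i + 1)
    rwa [add_right_comm, add_assoc] at this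

theorem Test.dyadic_apply (j : ℕ) (g : Test 𝕜 n) (x : Rn n) :
    Test.dyadic j g x = (2 : 𝕜) ^ (j * n) * g ((2 : ℝ) ^ j • x) := rfl

theorem Test.dyadic_zero (g : Test 𝕜 n) : Test.dyadic 0 g = g := by
  ext x; simp [Test.dyadic_apply]

theorem Test.SuppIn.dyadic {ρ : ℝ} {g : Test 𝕜 n} (hg : g.SuppIn ρ) (j : ℕ) :
    (Test.dyadic j g).SuppIn (ρ / 2 ^ j) := by
  intro x hx
  rw [Test.dyadic_apply, hg, mul_zero]
  rw [div_lt_iff₀' (by positivity)] at hx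
  rw [norm_smul]; simpa using hx

theorem Test.integral_dyadic (j : ℕ) (g : Test 𝕜 n) : ∫ x, Test.dyadic j g x = ∫ x, g x := by
  simp only [Test.dyadic_apply]
  rw [integral_const_mul, Measure.integral_comp_smul, finrank_euclideanSpace_fin,
    abs_of_pos (by positivity), ← pow_mul, RCLike.real_smul_eq_coe_mul, ← mul_assoc]
  push_cast
  rw [mul_inv_cancel₀ (pow_ne_zero _ two_ne_zero), one_mul]

theorem Test.integral_norm_dyadic (j : ℕ) (g : Test 𝕜 n) :
    ∫ x, ‖Test.dyadic j g x‖ = ∫ x, ‖g x‖ := by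
  simp only [Test.dyadic_apply, norm_mul, norm_pow, RCLike.norm_ofNat]
  rw [integral_const_mul, Measure.integral_comp_smul volume (fun x => ‖g x‖),
    finrank_euclideanSpace_fin, abs_of_pos (by positivity), ← pow_mul, smul_eq_mul, ← mul_assoc]
  simp

theorem Test.pnorm_dyadic_le (i j : ℕ) (g : Test 𝕜 n) :
    (Test.dyadic j g).pnorm i ≤ 2 ^ (j * (n + i)) * g.pnorm i := by
  refine Test.pnorm_le fun x => ?_
  have hg : ContDiff ℝ i g := g.contDiff.of_le (by exact_mod_cast le_top)
  have hg' : ContDiff ℝ i (fun x : Rn n => g ((2 : ℝ) ^ j • x)) :=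
    hg.comp (contDiff_const_smul _)
  have he : (Test.dyadic j g : Rn n → 𝕜) = ((2 : 𝕜) ^ (j * n)) • fun x => g ((2 : ℝ) ^ j • x) := by
    funext x; rw [Test.dyadic_apply]; rfl
  rw [he, iteratedFDeriv_const_smul_apply hg'.contDiffAt, iteratedFDeriv_comp_const_smul _ hg,
    norm_smul, norm_smul, mul_add, pow_add, mul_assoc]
  simp only [norm_pow, RCLike.norm_ofNat, ← pow_mul]
  gcongr
  exact g.norm_iteratedFDeriv_le_pnorm i _

/-- The difference form is what makes every later sum telescope. -/
theorem phiSeq_succ (φ₀ : Test 𝕜 n) (k : ℕ) :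
    phiSeq φ₀ (k + 1) = Test.dyadic (k + 1) φ₀ - Test.dyadic k φ₀ := by
  ext x
  simp only [phiSeq, phi, Test.dyadic_apply, sub_apply, smul_apply,
    Test.scale_apply, smul_eq_mul, mul_sub, smul_smul]
  congr 1
  have h1 : (1 / 2 : ℝ) * 2 ^ (k + 1) = 2 ^ k := by rw [pow_succ]; ring
  rw [h1, ← mul_assoc, add_mul, one_mul, pow_add, mul_assoc _ (2 ^ n),
    mul_inv_cancel₀ (pow_ne_zero _ two_ne_zero), mul_one]

theorem sum_phiSeq (φ₀ : Test 𝕜 n) (K : ℕ) :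
    ∑ k ∈ Finset.range (K + 1), phiSeq φ₀ k = Test.dyadic K φ₀ := by
  induction K with
  | zero => simp [phiSeq, Test.dyadic_zero]
  | succ K ih => rw [Finset.sum_range_succ, ih, phiSeq_succ]; abel

theorem exists_pnorm_phiSeq_le (φ₀ : Test 𝕜 n) (i : ℕ) :
    ∃ C, 0 ≤ C ∧ ∀ k, (phiSeq φ₀ k).pnorm i ≤ C * 2 ^ (k * (n + i)) := by
  refine ⟨φ₀.pnorm i + (phi φ₀).pnorm i,
    add_nonneg (Test.pnorm_nonneg _ _) (Test.pnorm_nonneg _ _), fun k => ?_⟩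
  have h1 := Test.pnorm_nonneg i φ₀
  have h2 := Test.pnorm_nonneg i (phi φ₀)
  cases k with
  | zero => simpa [phiSeq] using h2
  | succ k =>
    refine (Test.pnorm_dyadic_le i (k + 1) (phi φ₀)).trans ?_
    rw [mul_comm]
    gcongr
    linarith

theorem Test.SuppIn.phiSeq {ρ : ℝ} (hρ : 0 ≤ ρ) {φ₀ : Test 𝕜 n} (h : φ₀.SuppIn ρ) (k : ℕ) :
    (phiSeq φ₀ k).SuppIn (2 * ρ / 2 ^ k) := by
  cases k with
  | zero => exact h.mono (by simp; linarith)
  | succ k =>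
    rw [phiSeq_succ]
    refine ((h.dyadic (k + 1)).mono ?_).sub ((h.dyadic k).mono ?_)
    · gcongr; linarith
    · rw [pow_succ, mul_comm ((2 : ℝ) ^ k), mul_div_mul_left _ _ two_ne_zero]

/-- The kernels of the local reproducing formula
`φ_k = ∑_{d ≤ D} kern_{k,d} * φ_{k+d} + (1 - Φ_{k+D})^{L+1} φ_k`. -/
def kern (φ₀ : Test 𝕜 n) (L k : ℕ) : ℕ → Test 𝕜 n
  | 0 => ∑ i ∈ Finset.range (L + 1), (Test.errL (Test.dyadic k φ₀) ^ i) (Test.dyadic k φ₀)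
  | d + 1 => ∑ i ∈ Finset.range (L + 1), (Test.errL (Test.dyadic (k + d) φ₀) ^ i)
      ((Test.errL (Test.dyadic (k + d + 1) φ₀) ^ (L - i)) (phiSeq φ₀ k))

/-- Induction on D. For D = 0 the geometric sum gives (Σ_{i ≤ L} E^i)(1 - E) = 1 - E^{L+1} with E =
E_k. The step factors E_{k+D}^{L+1} - E_{k+D+1}^{L+1}, whose linear factor is convolution with
φ_{k+D+1}. -/
theorem phiSeq_eq_sum_cv_kern (φ₀ : Test 𝕜 n) (L k D : ℕ) :
    phiSeq φ₀ k = ∑ d ∈ Finset.range (D + 1), Test.cv (kern φ₀ L k d) (phiSeq φ₀ (k + d))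
      + (Test.errL (Test.dyadic (k + D) φ₀) ^ (L + 1)) (phiSeq φ₀ k) := by
  induction D with
  | zero =>
    have h1 : Test.cvL (kern φ₀ L k 0)
        = 1 - Test.errL (Test.dyadic k φ₀) ^ (L + 1) := by
      rw [kern, map_sum, Finset.sum_congr rfl fun i _ => Test.cvL_errL_pow _ _ i,
        ← Finset.sum_mul]
      have : Test.cvL (Test.dyadic k φ₀) = 1 - Test.errL (Test.dyadic k φ₀) := by
        simp [Test.errL]
      rw [this, geom_sum_mul_neg]
    simp only [zero_add, Finset.sum_range_one, add_zero, ← Test.cvL_apply, h1]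
    simp
  | succ D ih =>
    have h1 : Test.cv (kern φ₀ L k (D + 1)) (phiSeq φ₀ (k + (D + 1)))
        = (Test.errL (Test.dyadic (k + D) φ₀) ^ (L + 1)) (phiSeq φ₀ k)
          - (Test.errL (Test.dyadic (k + (D + 1)) φ₀) ^ (L + 1)) (phiSeq φ₀ k) := by
      rw [Test.cv_comm, ← Test.cvL_apply, ← add_assoc, phiSeq_succ]
      have h2 : Test.cvL (Test.dyadic (k + D + 1) φ₀ - Test.dyadic (k + D) φ₀)
          = Test.errL (Test.dyadic (k + D) φ₀) - Test.errL (Test.dyadic (k + D + 1) φ₀) := by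
        simp [Test.errL]
      have h3 := (Test.commute_errL (Test.dyadic (k + D) φ₀)
        (Test.dyadic (k + D + 1) φ₀)).mul_geom_sum₂ (L + 1)
      rw [h2, ← LinearMap.sub_apply, ← h3, Module.End.mul_apply, kern]
      simp only [LinearMap.sum_apply, Module.End.mul_apply, Nat.add_sub_cancel]
    rw [Finset.sum_range_succ, h1]
    nth_rewrite 1 [ih]
    abel

theorem exists_kern_suppIn (φ₀ : Test 𝕜 n) (L : ℕ) :
    ∃ ρ, 0 < ρ ∧ ∀ k d, (kern φ₀ L k d).SuppIn (ρ / 2 ^ k) := by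
  obtain ⟨ρ, hρ, h⟩ := φ₀.exists_suppIn
  refine ⟨(L + 2) * ρ, by positivity, fun k d => ?_⟩
  cases d with
  | zero =>
    refine Test.SuppIn.sum fun i hi => ?_
    refine (Test.SuppIn.errL_pow (by positivity) (h.dyadic k) (h.dyadic k) i).mono ?_
    have hi' : (i : ℝ) ≤ L := by exact_mod_cast Nat.lt_succ_iff.mp (Finset.mem_range.mp hi)
    rw [mul_div_assoc, ← add_one_mul]
    gcongr
    linarith
  | succ d =>
    refine Test.SuppIn.sum fun i hi => ?_
    have hi' : i ≤ L := Nat.lt_succ_iff.mp (Finset.mem_range.mp hi)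
    have hm : ∀ e, (Test.dyadic (k + e) φ₀).SuppIn (ρ / 2 ^ k) := fun e =>
      (h.dyadic (k + e)).mono (by gcongr <;> simp)
    refine (Test.SuppIn.errL_pow (by positivity) (hm d) (Test.SuppIn.errL_pow (by positivity)
      (hm (d + 1)) (Test.SuppIn.phiSeq hρ.le h k) (L - i)) i).mono ?_
    rw [mul_div_assoc, mul_div_assoc, ← add_mul, ← add_mul]
    refine mul_le_mul_of_nonneg_right ?_ (by positivity)
    rw [Nat.cast_sub hi']
    linarith

/-- For d ≥ 1 each summand applies exactly L operators E at scales about 2^{-(k+d)} to φ_k: they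
gain 2^{-(k+d)L}, and the L derivatives of φ_k cost 2^{k(n+L)}. -/
theorem exists_norm_kern_le (φ₀ : Test 𝕜 n) (h1 : ∫ x, φ₀ x = 1) (L : ℕ) :
    ∃ C, 0 ≤ C ∧ ∀ k d x, ‖kern φ₀ L k d x‖ ≤ C * 2 ^ (k * n) * (2 ^ (d * L))⁻¹ := by
  obtain ⟨ρ, hρ, h⟩ := φ₀.exists_suppIn
  obtain ⟨Cφ, hCφ, hφ⟩ := exists_pnorm_phiSeq_le φ₀ L
  set c := (∫ y, ‖φ₀ y‖) * ρ with hc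
  have hc0 : 0 ≤ c := mul_nonneg (integral_nonneg fun _ => norm_nonneg _) hρ.le
  have hE : ∀ j i m (g : Test 𝕜 n), ((Test.errL (Test.dyadic j φ₀) ^ m) g).pnorm i
      ≤ (c / 2 ^ j) ^ m * g.pnorm (i + m) := fun j i m g => by
    have := Test.pnorm_errL_pow_le (by positivity) (h.dyadic j)
      ((Test.integral_dyadic j φ₀).trans h1) i m g
    rwa [Test.integral_norm_dyadic, ← mul_div_assoc] at this
  set C₁ := ∑ i ∈ Finset.range (L + 1), c ^ i * φ₀.pnorm i
  set C₂ := (L + 1) * (2 * c) ^ L * Cφ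
  have hC₁ : 0 ≤ C₁ := Finset.sum_nonneg fun i _ =>
    mul_nonneg (pow_nonneg hc0 _) (Test.pnorm_nonneg _ _)
  have hC₂ : 0 ≤ C₂ := by positivity
  refine ⟨C₁ + C₂, by positivity, fun k d x => ((kern φ₀ L k d).norm_le_pnorm x).trans ?_⟩
  cases d with
  | zero =>
    have : (kern φ₀ L k 0).pnorm 0 ≤ C₁ * 2 ^ (k * n) := by
      refine (Test.pnorm_sum_le _ _ _).trans ?_
      rw [Finset.sum_mul]
      refine Finset.sum_le_sum fun i _ => (hE k 0 i _).trans ?_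
      rw [zero_add]
      calc (c / 2 ^ k) ^ i * (Test.dyadic k φ₀).pnorm i
          ≤ (c / 2 ^ k) ^ i * (2 ^ (k * (n + i)) * φ₀.pnorm i) := by
            gcongr; exact Test.pnorm_dyadic_le i k φ₀
        _ = c ^ i * φ₀.pnorm i * 2 ^ (k * n) := by
            rw [div_pow, mul_add, pow_add, ← pow_mul]
            field_simp
    simp only [zero_mul, pow_zero, inv_one, mul_one]
    refine this.trans ?_
    gcongr
    linarith
  | succ d =>
    have : (kern φ₀ L k (d + 1)).pnorm 0 ≤ C₂ * 2 ^ (k * n) * (2 ^ ((d + 1) * L))⁻¹ := by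
      refine (Test.pnorm_sum_le _ _ _).trans ?_
      have hterm : ∀ i ∈ Finset.range (L + 1),
          ((Test.errL (Test.dyadic (k + d) φ₀) ^ i)
            ((Test.errL (Test.dyadic (k + d + 1) φ₀) ^ (L - i)) (phiSeq φ₀ k))).pnorm 0
          ≤ (2 * c) ^ L * Cφ * 2 ^ (k * n) * (2 ^ ((d + 1) * L))⁻¹ := by
        intro i hi
        have hi' : i ≤ L := Nat.lt_succ_iff.mp (Finset.mem_range.mp hi)
        -- Brings the factors of both scales to the common base 2c / 2^{k+d+1}, so that the powers i
        -- and L - i combine.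
        have e1 : c / 2 ^ (k + d) = 2 * c / 2 ^ (k + d + 1) := by
          rw [pow_succ, mul_comm _ (2 : ℝ), mul_div_mul_left _ _ two_ne_zero]
        calc _ ≤ (c / 2 ^ (k + d)) ^ i * ((c / 2 ^ (k + d + 1)) ^ (L - i)
                * (phiSeq φ₀ k).pnorm (0 + i + (L - i))) :=
              (hE _ _ _ _).trans (by gcongr; exact hE _ _ _ _)
          _ ≤ (2 * c / 2 ^ (k + d + 1)) ^ i * ((2 * c / 2 ^ (k + d + 1)) ^ (L - i)
                * (Cφ * 2 ^ (k * (n + L)))) := by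
              rw [e1, zero_add, Nat.add_sub_cancel' hi']
              have := Test.pnorm_nonneg L (phiSeq φ₀ k)
              have h2 : c ≤ 2 * c := by linarith
              gcongr
              exact hφ k
          _ = (2 * c / 2 ^ (k + d + 1)) ^ L * (Cφ * 2 ^ (k * (n + L))) := by
              rw [← mul_assoc, ← pow_add, Nat.add_sub_cancel' hi']
          _ = _ := by
              rw [div_pow, ← pow_mul, add_assoc, add_mul, mul_add, pow_add, pow_add]
              field_simp
      refine (Finset.sum_le_card_nsmul _ _ _ hterm).trans (le_of_eq ?_)
      rw [Finset.card_range, nsmul_eq_mul]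
      push_cast
      ring
    refine this.trans ?_
    gcongr
    linarith

end TestFunctions

/-! ### Convolution with a distribution of exponential growth -/

section Convolution

open scoped ContDiff
open Filter Topology

variable {𝕜 : Type*} [RCLike 𝕜] {n : ℕ}

theorem norm_iteratedFDeriv_comp_sub_left {F : Type*} [NormedAddCommGroup F] [NormedSpace ℝ F]
    (i : ℕ) (G : Rn n → F) (x y : Rn n) :
    ‖iteratedFDeriv ℝ i (fun y => G (x - y)) y‖ = ‖iteratedFDeriv ℝ i G (x - y)‖ := by
  have h1 := (LinearIsometryEquiv.neg ℝ (E := Rn n)).norm_iteratedFDeriv_comp_right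
    (fun z => G (x + z)) y i
  have h2 : (fun z => G (x + z)) ∘ (LinearIsometryEquiv.neg ℝ (E := Rn n))
      = fun y => G (x - y) := by
    funext z; simp [sub_eq_add_neg]
  rw [h2, iteratedFDeriv_comp_add_left] at h1
  simpa [sub_eq_add_neg] using h1

theorem Test.iteratedFDeriv_eq_zero {ρ : ℝ} {g : Test 𝕜 n} (hg : g.SuppIn ρ) (i : ℕ)
    {x : Rn n} (hx : ρ < ‖x‖) : iteratedFDeriv ℝ i g x = 0 := by
  by_contra hne
  have h1 : x ∈ tsupport g := support_iteratedFDeriv_subset i hne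
  have h2 : tsupport g ⊆ Metric.closedBall 0 ρ := by
    refine closure_minimal (fun y hy => ?_) Metric.isClosed_closedBall
    rw [mem_closedBall_zero_iff]
    by_contra hlt
    exact hy (hg y (not_le.mp hlt))
  have := h2 h1
  rw [mem_closedBall_zero_iff] at this
  linarith

/-- On functions supported in a fixed ball the exponential weight is a constant, so finitely many
sup seminorms control f. All later limits are taken in these seminorms. -/
theorem IsExpDistr.exists_bound {f : Distr 𝕜 n} (hf : IsExpDistr f) :
    ∃ (C : ℝ) (N : ℕ), 0 ≤ C ∧ ∀ (ψ : Test 𝕜 n) (ρ : ℝ), ψ.SuppIn ρ →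
      ‖f ψ‖ ≤ C * Real.exp (N * ρ) * ∑ i ∈ Finset.range (N + 1), ψ.pnorm i := by
  obtain ⟨C, N, h⟩ := hf
  refine ⟨|C|, N, abs_nonneg C, fun ψ ρ hψ => ?_⟩
  have hs : 0 ≤ ∑ i ∈ Finset.range (N + 1), ψ.pnorm i :=
    Finset.sum_nonneg fun i _ => ψ.pnorm_nonneg i
  refine (h ψ (Real.exp (N * ρ) * ∑ i ∈ Finset.range (N + 1), ψ.pnorm i)
    fun i hi x => ?_).trans ?_
  · by_cases hx : ρ < ‖x‖
    · rw [Test.iteratedFDeriv_eq_zero hψ i hx, norm_zero, zero_mul]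
      positivity
    · rw [mul_comm]
      have h1 : ‖iteratedFDeriv ℝ i ψ x‖ ≤ ∑ i ∈ Finset.range (N + 1), ψ.pnorm i :=
        (ψ.norm_iteratedFDeriv_le_pnorm i x).trans
          (Finset.single_le_sum (f := fun i => ψ.pnorm i) (fun i _ => ψ.pnorm_nonneg i)
            (Finset.mem_range.mpr (Nat.lt_succ_of_le hi)))
      gcongr
      exact not_lt.mp hx
  · rw [mul_assoc]
    exact mul_le_mul_of_nonneg_right (le_abs_self C) (by positivity)

theorem Test.pnorm_reflect_le (i : ℕ) (x : Rn n) (g : Test 𝕜 n) :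
    (Test.reflect x g).pnorm i ≤ g.pnorm i := by
  refine Test.pnorm_le fun y => ?_
  have : (Test.reflect x g : Rn n → 𝕜) = fun y => g (x - y) := rfl
  rw [this, norm_iteratedFDeriv_comp_sub_left]
  exact g.norm_iteratedFDeriv_le_pnorm i _

theorem Test.SuppIn.reflect {ρ : ℝ} {g : Test 𝕜 n} (hg : g.SuppIn ρ) (x : Rn n) :
    (Test.reflect x g).SuppIn (ρ + ‖x‖) := by
  intro y hy
  rw [Test.reflect_apply]
  refine hg _ ?_
  have := norm_sub_norm_le y x
  rw [norm_sub_rev]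
  linarith

theorem Test.norm_iteratedFDeriv_sub_le (i : ℕ) (g : Test 𝕜 n) (u v : Rn n) :
    ‖iteratedFDeriv ℝ i g u - iteratedFDeriv ℝ i g v‖ ≤ g.pnorm (i + 1) * ‖u - v‖ :=
  Convex.norm_image_sub_le_of_norm_fderiv_le (s := Set.univ) (𝕜 := ℝ)
    (fun z _ => (g.contDiff.differentiable_iteratedFDeriv
      (by exact_mod_cast WithTop.coe_lt_top _)).differentiableAt)
    (fun z _ => by
      rw [norm_fderiv_iteratedFDeriv]; exact g.norm_iteratedFDeriv_le_pnorm (i + 1) z)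
    convex_univ trivial trivial

theorem Test.pnorm_reflect_sub_reflect_le (i : ℕ) (x x' : Rn n) (g : Test 𝕜 n) :
    (Test.reflect x g - Test.reflect x' g).pnorm i ≤ g.pnorm (i + 1) * ‖x - x'‖ := by
  refine Test.pnorm_le fun y => ?_
  have hg : ContDiff ℝ i g := g.contDiff.of_le (by exact_mod_cast le_top)
  have h1 : (Test.reflect x g - Test.reflect x' g : Test 𝕜 n)
      = fun y => (fun z => g (x + z) - g (x' + z)) (0 - y) := by
    funext z; simp [Test.reflect_apply, sub_eq_add_neg]
  have h2 : ∀ x, ContDiff ℝ i fun z => g (x + z) := fun x =>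
    hg.comp (contDiff_const.add contDiff_id)
  have h3 := fun z => iteratedFDeriv_sub_apply (x := z) (h2 x).contDiffAt (h2 x').contDiffAt
  have h4 : (fun z => g (x + z) - g (x' + z)) = (fun z => g (x + z)) - fun z => g (x' + z) := rfl
  rw [h1, norm_iteratedFDeriv_comp_sub_left i (fun z => g (x + z) - g (x' + z)), h4, h3, iteratedFDeriv_comp_add_left,
    iteratedFDeriv_comp_add_left]
  refine (g.norm_iteratedFDeriv_sub_le i _ _).trans (le_of_eq ?_)
  rw [add_sub_add_right_eq_sub]

theorem Test.reflect_add (x : Rn n) (g h : Test 𝕜 n) :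
    Test.reflect x (g + h) = Test.reflect x g + Test.reflect x h := rfl

theorem conv_add (g h : Test 𝕜 n) (f : Distr 𝕜 n) (x : Rn n) :
    conv (g + h) f x = conv g f x + conv h f x := by
  rw [conv, Test.reflect_add, map_add]; rfl

theorem conv_sub (g h : Test 𝕜 n) (f : Distr 𝕜 n) (x : Rn n) :
    conv (g - h) f x = conv g f x - conv h f x := by
  rw [eq_sub_iff_add_eq, ← conv_add, sub_add_cancel]

theorem conv_sum {ι : Type*} (s : Finset ι) (g : ι → Test 𝕜 n) (f : Distr 𝕜 n) (x : Rn n) :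
    conv (∑ a ∈ s, g a) f x = ∑ a ∈ s, conv (g a) f x := by
  classical
  induction s using Finset.induction_on with
  | empty =>
    have : Test.reflect x (0 : Test 𝕜 n) = 0 := rfl
    simp [conv, this]
  | insert a s ha ih => rw [Finset.sum_insert ha, Finset.sum_insert ha, conv_add, ih]

theorem norm_conv_le {f : Distr 𝕜 n} {C : ℝ} {N : ℕ} (hC : 0 ≤ C)
    (hf : ∀ (ψ : Test 𝕜 n) (ρ : ℝ), ψ.SuppIn ρ →
      ‖f ψ‖ ≤ C * Real.exp (N * ρ) * ∑ i ∈ Finset.range (N + 1), ψ.pnorm i)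
    {g : Test 𝕜 n} {ρ : ℝ} (hg : g.SuppIn ρ) (x : Rn n) :
    ‖conv g f x‖ ≤ C * Real.exp (N * (ρ + ‖x‖)) * ∑ i ∈ Finset.range (N + 1), g.pnorm i := by
  refine (hf _ _ (hg.reflect x)).trans ?_
  gcongr with i _
  exact Test.pnorm_reflect_le i x g

theorem IsExpDistr.exists_norm_conv_sub_le {f : Distr 𝕜 n} (hf : IsExpDistr f) (g : Test 𝕜 n)
    (R : ℝ) : ∃ K, 0 ≤ K ∧ ∀ x x' : Rn n, ‖x‖ ≤ R → ‖x'‖ ≤ R →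
      ‖conv g f x - conv g f x'‖ ≤ K * ‖x - x'‖ := by
  obtain ⟨C, N, hC, h⟩ := hf.exists_bound
  obtain ⟨ρ, hρ, hg⟩ := g.exists_suppIn
  have hs : 0 ≤ ∑ i ∈ Finset.range (N + 1), g.pnorm (i + 1) :=
    Finset.sum_nonneg fun i _ => g.pnorm_nonneg _
  refine ⟨C * Real.exp (N * (ρ + R)) * ∑ i ∈ Finset.range (N + 1), g.pnorm (i + 1),
    by positivity, fun x x' hx hx' => ?_⟩
  rw [conv, conv, ← map_sub]
  refine (h _ (ρ + R) (((hg.reflect x).mono (by linarith)).sub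
    ((hg.reflect x').mono (by linarith)))).trans ?_
  rw [mul_assoc _ (∑ i ∈ _, _), Finset.sum_mul]
  gcongr with i _
  exact Test.pnorm_reflect_sub_reflect_le i x x' g

theorem IsExpDistr.continuous_conv {f : Distr 𝕜 n} (hf : IsExpDistr f) (g : Test 𝕜 n) :
    Continuous (conv g f) := by
  refine continuous_iff_continuousAt.mpr fun x => ?_
  obtain ⟨K, hK, h⟩ := hf.exists_norm_conv_sub_le g (‖x‖ + 1)
  rw [ContinuousAt, tendsto_iff_norm_sub_tendsto_zero]
  have h1 : Tendsto (fun y => K * ‖y - x‖) (𝓝 x) (𝓝 0) := by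
    have : Continuous fun y : Rn n => K * ‖y - x‖ := by fun_prop
    simpa using this.tendsto x
  refine squeeze_zero' (Eventually.of_forall fun _ => norm_nonneg _) ?_ h1
  filter_upwards [Metric.ball_mem_nhds x one_pos] with y hy
  rw [mem_ball_iff_norm] at hy
  exact h y x (by have := norm_sub_norm_le y x; linarith) (by linarith)

theorem exists_simpleFunc_dist_le {K : Set (Rn n)} (hK : IsCompact K) {ε : ℝ} (hε : 0 < ε) :
    ∃ s : SimpleFunc (Rn n) (Rn n), ∀ y ∈ K, ‖s y - y‖ ≤ ε := by
  obtain ⟨t, ht⟩ := hK.elim_finite_subcover (fun i : ℕ => Metric.ball (denseSeq (Rn n) i) ε)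
    (fun i => Metric.isOpen_ball) (fun y _ => by
      obtain ⟨i, hi⟩ := (denseRange_denseSeq (Rn n)).exists_dist_lt y hε
      exact Set.mem_iUnion.mpr ⟨i, hi⟩)
  refine ⟨SimpleFunc.nearestPt (denseSeq (Rn n)) (t.sup id), fun y hy => ?_⟩
  obtain ⟨i, hi, hyi⟩ := Set.mem_iUnion₂.mp (ht hy)
  have h1 := SimpleFunc.edist_nearestPt_le (denseSeq (Rn n)) y
    (Finset.le_sup (f := id) hi : i ≤ t.sup id)
  rw [edist_dist, edist_dist, ENNReal.ofReal_le_ofReal_iff dist_nonneg] at h1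
  rw [← dist_eq_norm]
  rw [Metric.mem_ball, dist_comm] at hyi
  exact h1.trans hyi.le

theorem integral_mul_simpleFunc {h : Rn n → 𝕜} (hh : Integrable h)
    (s : SimpleFunc (Rn n) (Rn n)) (F : Rn n → 𝕜) :
    ∫ z, h z * F (s z) = ∑ v ∈ s.range, (∫ z in s ⁻¹' {v}, h z) * F v := by
  have h1 : ∀ z, h z * F (s z) = ∑ v ∈ s.range, (s ⁻¹' {v}).indicator h z * F v := by
    intro z
    rw [Finset.sum_eq_single (s z)]
    · simp
    · intro v _ hv
      rw [Set.indicator_of_notMem (by simpa using hv.symm), zero_mul]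
    · intro hz; exact absurd (s.mem_range_self z) hz
  simp_rw [h1]
  rw [integral_finsetSum _ fun v _ =>
    (hh.indicator (s.measurableSet_preimage _)).mul_const _]
  refine Finset.sum_congr rfl fun v _ => ?_
  rw [integral_mul_const, integral_indicator (s.measurableSet_preimage _)]

/-- Passing f under the integral is done by Riemann sums: replacing y by a simple function s(y)
turns the integral into a finite linear combination of translates of g, to which linearity of f
applies. -/
theorem IsExpDistr.conv_cv {f : Distr 𝕜 n} (hf : IsExpDistr f) (h g : Test 𝕜 n) (x : Rn n) :
    conv (Test.cv h g) f x = ∫ y, h y * conv g f (x - y) := by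
  obtain ⟨C, N, hC, hb⟩ := hf.exists_bound
  obtain ⟨ρ, hρ, hg⟩ := g.exists_suppIn
  obtain ⟨ρ', hρ', hh⟩ := h.exists_suppIn
  obtain ⟨K, hK, hl⟩ := hf.exists_norm_conv_sub_le g (‖x‖ + ρ' + 1)
  set I := ∫ z, ‖h z‖
  have hI : 0 ≤ I := integral_nonneg fun _ => norm_nonneg _
  set S := ∑ i ∈ Finset.range (N + 1), g.pnorm (i + 1)
  have hS : 0 ≤ S := Finset.sum_nonneg fun i _ => g.pnorm_nonneg _
  set A := C * Real.exp (N * (‖x‖ + ρ + ρ' + 1)) * (I * S) + I * K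
  -- ε is the mesh of the Riemann sum; ε ≤ 1 only keeps all supports and points in one ball
  -- independent of ε.
  have key : ∀ ε, 0 < ε → ε ≤ 1 →
      ‖conv (Test.cv h g) f x - ∫ y, h y * conv g f (x - y)‖ ≤ A * ε := by
    intro ε hε hε1
    obtain ⟨s, hs⟩ := exists_simpleFunc_dist_le h.hasCompactSupport.isCompact hε
    have hs' : ∀ z, h z ≠ 0 → ‖z - s z‖ ≤ ε := fun z hz => by
      rw [norm_sub_rev]; exact hs z (subset_tsupport _ hz)
    have hz' : ∀ z, h z ≠ 0 → ‖z‖ ≤ ρ' := fun z hz => by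
      by_contra hlt; exact hz (hh z (not_le.mp hlt))
    have hsz : ∀ z, h z ≠ 0 → ‖s z‖ ≤ ρ' + 1 := fun z hz => by
      have h1 := norm_sub_norm_le (s z) z
      rw [norm_sub_rev] at h1
      linarith [hs' z hz, hz' z hz]
    -- The error of the Riemann sum as a test function. All its seminorms are O(ε), so f T is O(ε);
    -- the rest of the error comes from the Lipschitz bound for g * f.
    set T : Test 𝕜 n := Test.reflect x (Test.cv h g)
      - ∑ v ∈ s.range, (∫ z in s ⁻¹' {v}, h z) • Test.reflect (x - v) g
    have hgint : ∀ w, Integrable (fun z => h z * g (w - s z)) (volume : Measure (Rn n)) := by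
      intro w
      refine h.integrable.mul_bdd (c := g.pnorm 0) ?_ (Eventually.of_forall fun z =>
        g.norm_le_pnorm _)
      exact g.continuous.comp_aestronglyMeasurable
        (measurable_const.sub s.measurable).aestronglyMeasurable
    have hT : (T : Rn n → 𝕜)
        = fun y => (fun w => ∫ z, h z • (g (w - id z) - g (w - s z))) (x - y) := by
      funext y
      have e1 : (∑ v ∈ s.range, (∫ z in s ⁻¹' {v}, h z) • Test.reflect (x - v) g : Test 𝕜 n) y
          = ∫ z, h z * g (x - y - s z) := by
        rw [integral_mul_simpleFunc h.integrable s fun v => g (x - y - v)]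
        have : ∀ (t : Finset (Rn n)) (c : Rn n → 𝕜),
            (∑ v ∈ t, c v • Test.reflect (x - v) g : Test 𝕜 n) y
              = ∑ v ∈ t, c v * g (x - y - v) := by
          classical
          intro t c
          induction t using Finset.induction_on with
          | empty => simp
          | insert a t ha ih =>
            rw [Finset.sum_insert ha, Finset.sum_insert ha, add_apply, ih, smul_apply,
              Test.reflect_apply, smul_eq_mul, sub_right_comm]
        exact this _ _
      simp only [smul_eq_mul, mul_sub, id]
      rw [integral_sub (h.integrable_mul_comp_sub g (x - y)) (hgint _), ← Test.cv_apply, ← e1]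
      rfl
    have hTsupp : T.SuppIn (‖x‖ + ρ + ρ' + 1) := by
      intro y hy
      rw [hT]
      refine integral_eq_zero_of_ae (Eventually.of_forall fun z => ?_)
      by_cases hz : h z = 0
      · simp [hz]
      · have n1 : ‖y‖ - ‖x‖ ≤ ‖x - y‖ := by
          rw [norm_sub_rev]; exact norm_sub_norm_le y x
        have n2 := norm_sub_norm_le (x - y) z
        have n3 := norm_sub_norm_le (x - y) (s z)
        simp only [id]
        rw [hg _ (by linarith [hz' z hz]), hg _ (by linarith [hsz z hz])]
        simp
    have hTn : ∀ i, T.pnorm i ≤ I * g.pnorm (i + 1) * ε := by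
      intro i
      refine Test.pnorm_le fun y => ?_
      rw [hT, norm_iteratedFDeriv_comp_sub_left i
        (fun w => ∫ z, h z • (g (w - id z) - g (w - s z))), mul_right_comm]
      exact norm_iteratedFDeriv_integral_smul_sub_le h.integrable measurable_id s.measurable
        hs' i g.contDiff g.hasCompactSupport (g.norm_iteratedFDeriv_le_pnorm (i + 1)) _
    have hfT : f T = conv (Test.cv h g) f x - ∫ z, h z * conv g f (x - s z) := by
      rw [integral_mul_simpleFunc h.integrable s fun v => conv g f (x - v)]
      simp only [T, map_sub, map_sum, map_smul, smul_eq_mul]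
      rfl
    have b1 : ‖f T‖ ≤ C * Real.exp (N * (‖x‖ + ρ + ρ' + 1)) * (I * S) * ε := by
      refine (hb T _ hTsupp).trans ?_
      rw [mul_assoc _ (I * S)]
      refine mul_le_mul_of_nonneg_left ?_ (by positivity)
      simp only [S]
      rw [Finset.mul_sum, Finset.sum_mul]
      exact Finset.sum_le_sum fun i _ => hTn i
    have hc := hf.continuous_conv g
    have i1 : Integrable (fun z => h z * conv g f (x - z)) (volume : Measure (Rn n)) :=
      Continuous.integrable_of_hasCompactSupport (by fun_prop) h.hasCompactSupport.mul_right
    have hptw : ∀ z, ‖h z * (conv g f (x - s z) - conv g f (x - z))‖ ≤ ‖h z‖ * (K * ε) := by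
      intro z
      rw [norm_mul]
      by_cases hz : h z = 0
      · simp [hz]
      · refine mul_le_mul_of_nonneg_left ?_ (norm_nonneg _)
        refine (hl _ _ ?_ ?_).trans ?_
        · linarith [norm_sub_le x (s z), hsz z hz]
        · linarith [norm_sub_le x z, hz' z hz]
        · rw [sub_sub_sub_cancel_left]
          gcongr
          exact hs' z hz
    have i2 : Integrable (fun z => h z * (conv g f (x - s z) - conv g f (x - z)))
        (volume : Measure (Rn n)) := by
      refine (h.integrable.norm.mul_const (K * ε)).mono' ?_ (Eventually.of_forall hptw)
      refine h.continuous.aestronglyMeasurable.mul ?_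
      refine (hc.comp_aestronglyMeasurable ?_).sub (by fun_prop)
      exact (measurable_const.sub s.measurable).aestronglyMeasurable
    have e2 : (∫ z, h z * conv g f (x - s z)) - ∫ z, h z * conv g f (x - z)
        = ∫ z, h z * (conv g f (x - s z) - conv g f (x - z)) := by
      rw [sub_eq_iff_eq_add, ← integral_add i2 i1]
      congr 1; funext z; ring
    have b2 : ‖∫ z, h z * (conv g f (x - s z) - conv g f (x - z))‖ ≤ I * K * ε := by
      rw [mul_assoc, ← integral_mul_const]
      exact norm_integral_le_of_norm_le (h.integrable.norm.mul_const _)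
        (Eventually.of_forall hptw)
    calc ‖conv (Test.cv h g) f x - ∫ y, h y * conv g f (x - y)‖
        = ‖f T + ∫ z, h z * (conv g f (x - s z) - conv g f (x - z))‖ := by
          rw [hfT, ← e2]; congr 1; ring
      _ ≤ _ := (norm_add_le _ _).trans ((add_le_add b1 b2).trans (le_of_eq (by ring)))
  have hA : 0 ≤ A := by positivity
  rw [← sub_eq_zero, ← norm_le_zero_iff]
  refine le_of_forall_pos_le_add fun δ hδ => ?_
  refine (key (min 1 (δ / (A + 1))) (by positivity) (min_le_left _ _)).trans ?_
  rw [zero_add]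
  calc A * min 1 (δ / (A + 1)) ≤ A * (δ / (A + 1)) := by gcongr; exact min_le_right _ _
    _ ≤ δ := by
      rw [← mul_div_assoc, div_le_iff₀ (by positivity)]; nlinarith

/-- Each seminorm of E_J^{L+1} g is O(2^{-J(L+1)}) and the supports stay in a fixed ball. This
removes the remainder of the reproducing formula. -/
theorem IsExpDistr.tendsto_conv_errL_pow {f : Distr 𝕜 n} (hf : IsExpDistr f) {φ₀ : Test 𝕜 n}
    (h1 : ∫ x, φ₀ x = 1) (g : Test 𝕜 n) (x : Rn n) (L : ℕ) :
    Tendsto (fun J => conv ((Test.errL (Test.dyadic J φ₀) ^ (L + 1)) g) f x) atTop (𝓝 0) := by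
  obtain ⟨C, N, hC, hb⟩ := hf.exists_bound
  obtain ⟨ρ, hρ, hg⟩ := g.exists_suppIn
  obtain ⟨ρ', hρ', hφ⟩ := φ₀.exists_suppIn
  set c := (∫ y, ‖φ₀ y‖) * ρ'
  have hc0 : 0 ≤ c := mul_nonneg (integral_nonneg fun _ => norm_nonneg _) hρ'.le
  have hb' : ∀ J, ‖conv ((Test.errL (Test.dyadic J φ₀) ^ (L + 1)) g) f x‖
      ≤ C * Real.exp (N * (((L + 1 : ℕ) * ρ' + ρ) + ‖x‖))
        * ∑ i ∈ Finset.range (N + 1), (c / 2 ^ J) ^ (L + 1) * g.pnorm (i + (L + 1)) := by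
    intro J
    refine (norm_conv_le hC hb (Test.SuppIn.errL_pow hρ'.le ((hφ.dyadic J).mono ?_) hg
      (L + 1)) x).trans ?_
    · exact div_le_self hρ'.le (one_le_pow₀ one_le_two)
    · gcongr with i _
      have := Test.pnorm_errL_pow_le (by positivity) (hφ.dyadic J)
        ((Test.integral_dyadic J φ₀).trans h1) i (L + 1) g
      rwa [Test.integral_norm_dyadic, ← mul_div_assoc] at this
  refine squeeze_zero_norm hb' ?_
  have t0 : Tendsto (fun J : ℕ => c / (2 : ℝ) ^ J) atTop (𝓝 0) :=
    (tendsto_pow_atTop_atTop_of_one_lt one_lt_two).const_div_atTop c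
  have t1 : Tendsto (fun J : ℕ => C * Real.exp (N * (((L + 1 : ℕ) * ρ' + ρ) + ‖x‖))
        * ∑ i ∈ Finset.range (N + 1), (c / 2 ^ J) ^ (L + 1) * g.pnorm (i + (L + 1))) atTop
      (𝓝 (C * Real.exp (N * (((L + 1 : ℕ) * ρ' + ρ) + ‖x‖))
        * ∑ i ∈ Finset.range (N + 1), 0 ^ (L + 1) * g.pnorm (i + (L + 1)))) :=
    (tendsto_finsetSum _ fun i _ => (t0.pow (L + 1)).mul_const _).const_mul _
  simpa using t1

theorem IsExpDistr.tendsto_integral_conv_dyadic {f : Distr 𝕜 n} (hf : IsExpDistr f)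
    {φ₀ : Test 𝕜 n} (h1 : ∫ x, φ₀ x = 1) (ψ : Test 𝕜 n) :
    Tendsto (fun K => ∫ x, conv (Test.dyadic K φ₀) f x * ψ x) atTop (𝓝 (f ψ)) := by
  -- The pairing with ψ is a convolution with the reflection of ψ, evaluated at 0; the error is then
  -- the remainder above with L = 0.
  have e1 : ∀ K, ∫ x, conv (Test.dyadic K φ₀) f x * ψ x
      = f ψ - conv ((Test.errL (Test.dyadic K φ₀) ^ (0 + 1)) (Test.reflect 0 ψ)) f 0 := by
    intro K
    have h2 : Test.cv (Test.reflect 0 ψ) (Test.dyadic K φ₀)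
        = Test.reflect 0 ψ - Test.errL (Test.dyadic K φ₀) (Test.reflect 0 ψ) := by
      rw [Test.errL_apply, sub_sub_cancel, Test.cv_comm]
    have h3 := hf.conv_cv (Test.reflect 0 ψ) (Test.dyadic K φ₀) 0
    have h4 : conv (Test.reflect 0 ψ) f 0 = f ψ := by
      rw [conv]
      congr 1
      ext y
      simp [Test.reflect_apply]
    rw [h2, conv_sub, h4] at h3
    rw [zero_add, pow_one, h3, ← integral_neg_eq_self]
    refine integral_congr_ae (Eventually.of_forall fun y => ?_)
    simp [Test.reflect_apply, mul_comm]
  simp_rw [e1]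
  simpa using (hf.tendsto_conv_errL_pow h1 (Test.reflect 0 ψ) 0 0).const_sub (f ψ)

end Convolution

/-! ### Absorption, interpolation and local means -/

section Inequalities

/-- Young's inequality with ε, by comparing x with M w for M = ε^{-1/s}. This argument includes s =
1, where the conjugate exponents degenerate. -/
theorem exists_rpow_mul_rpow_le {s : ℝ} (hs : 0 < s) (hs1 : s ≤ 1) {ε : ℝ≥0∞} (hε : ε ≠ 0)
    (hε' : ε ≠ ∞) :
    ∃ δ : ℝ≥0∞, δ ≠ ∞ ∧ ∀ x w : ℝ≥0∞, x ^ (1 - s) * w ^ s ≤ ε * x + δ * w := by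
  set M : ℝ≥0∞ := ε ^ (-(1 / s)) with hM
  have hM0 : M ≠ 0 := by simp [hM, ENNReal.rpow_eq_zero_iff, hε, hε']
  have hMt : M ≠ ∞ := by simp [hM, ENNReal.rpow_eq_top_iff, hε, hε']
  have h1s : 0 ≤ 1 - s := sub_nonneg.mpr hs1
  refine ⟨M ^ (1 - s), ENNReal.rpow_ne_top_of_nonneg h1s hMt, fun x w => ?_⟩
  rcases le_total x (M * w) with h | h
  · calc x ^ (1 - s) * w ^ s ≤ (M * w) ^ (1 - s) * w ^ s := by gcongr
      _ = M ^ (1 - s) * w := by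
        rw [ENNReal.mul_rpow_of_nonneg _ _ h1s, mul_assoc, ← ENNReal.rpow_add_of_nonneg _ _ h1s hs.le]
        simp
      _ ≤ _ := le_add_self
  · have h2 : w ≤ M⁻¹ * x := by
      calc w = M⁻¹ * (M * w) := by rw [← mul_assoc, ENNReal.inv_mul_cancel hM0 hMt, one_mul]
        _ ≤ _ := by gcongr
    calc x ^ (1 - s) * w ^ s ≤ x ^ (1 - s) * (M⁻¹ * x) ^ s := by gcongr
      _ = M⁻¹ ^ s * x := by
        rw [ENNReal.mul_rpow_of_nonneg _ _ hs.le, mul_left_comm,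
          ← ENNReal.rpow_add_of_nonneg _ _ h1s hs.le]
        simp
      _ = ε * x := by
        rw [hM, ENNReal.rpow_neg, inv_inv, ← ENNReal.rpow_mul, one_div, inv_mul_cancel₀ hs.ne',
          ENNReal.rpow_one]
      _ ≤ _ := le_self_add

theorem tsum_two_inv_pow : ∑' d : ℕ, (2⁻¹ : ℝ≥0∞) ^ d = 2 := by
  rw [ENNReal.tsum_geometric, ENNReal.one_sub_inv_two, inv_inv]

/-- A sequence of moderate growth that is dominated by a sum of geometric means of its later terms
and those of `w` is dominated by the later terms of `w`. -/
theorem exists_le_tsum_of_le_tsum_rpow_mul {X W : ℕ → ℝ≥0∞} {s : ℝ} (hs : 0 < s) (hs1 : s ≤ 1)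
    {C C₀ : ℝ≥0∞} (hC : C ≠ ∞) (hC₀ : C₀ ≠ ∞) {A L : ℕ} (hAL : A ≤ L)
    (hX : ∀ j, X j ≤ C₀ * 2 ^ (j * A))
    (h : ∀ k, X k ≤ C * ∑' d : ℕ, 2⁻¹ ^ (d * (L + 1)) * (X (k + d) ^ (1 - s) * W (k + d) ^ s)) :
    ∃ C' : ℝ≥0∞, C' ≠ ∞ ∧ ∀ k, X k ≤ C' * ∑' d : ℕ, 2⁻¹ ^ (d * L) * W (k + d) := by
  -- Chosen so that C ε Σ_d 2^{-d} ≤ 1/2; the 1 in C + 1 covers C = 0.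
  set ε : ℝ≥0∞ := (4 * (C + 1))⁻¹ with hε
  have hC1 : 4 * (C + 1) ≠ ∞ := by finiteness
  have hC0 : 4 * (C + 1) ≠ 0 := by simp
  have hCε : C * ε * 2 ≤ 2⁻¹ := by
    calc C * ε * 2 ≤ (C + 1) * ε * 2 := by gcongr; exact le_self_add
      _ = 2⁻¹ * ((4 * (C + 1)) * ε) := by
        have : (2 : ℝ≥0∞) = 2⁻¹ * 4 := by
          rw [show (4 : ℝ≥0∞) = 2 * 2 by norm_num, ← mul_assoc,
            ENNReal.inv_mul_cancel two_ne_zero (by simp), one_mul]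
        calc (C + 1) * ε * 2 = (C + 1) * ε * (2⁻¹ * 4) := by rw [← this]
          _ = _ := by ring
      _ = 2⁻¹ := by rw [hε, ENNReal.mul_inv_cancel hC0 hC1, mul_one]
  obtain ⟨δ, hδ, hy⟩ := exists_rpow_mul_rpow_le hs hs1 (ε := ε)
    (ENNReal.inv_ne_zero.mpr hC1) (ENNReal.inv_ne_top.mpr hC0)
  refine ⟨2 * (C * δ), by finiteness, fun k => ?_⟩
  set T := ∑' d : ℕ, (2⁻¹ : ℝ≥0∞) ^ (d * L) * W (k + d)
  -- The quantity to absorb. It is finite because the growth 2^{jA} of X is beaten by 2^{-eL}, L ≥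
  -- A; without finiteness S ≤ S/2 + CδT would say nothing.
  set S := ⨆ e : ℕ, (2⁻¹ : ℝ≥0∞) ^ (e * L) * X (k + e) with hS
  have hStop : S ≠ ∞ := by
    refine ne_top_of_le_ne_top (b := C₀ * 2 ^ (k * A)) (by finiteness) (iSup_le fun e => ?_)
    calc (2⁻¹ : ℝ≥0∞) ^ (e * L) * X (k + e)
        ≤ 2⁻¹ ^ (e * L) * (C₀ * 2 ^ ((k + e) * A)) := by gcongr; exact hX _
      _ = C₀ * 2 ^ (k * A) * (2⁻¹ ^ (e * L) * 2 ^ (e * A)) := by rw [add_mul, pow_add]; ring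
      _ ≤ C₀ * 2 ^ (k * A) * (2⁻¹ ^ (e * L) * 2 ^ (e * L)) := by gcongr; exact one_le_two
      _ = C₀ * 2 ^ (k * A) := by
        rw [← mul_pow, ENNReal.inv_mul_cancel two_ne_zero (by simp), one_pow, mul_one]
  have hle : S ≤ 2⁻¹ * S + C * δ * T := by
    refine iSup_le fun e => ?_
    calc (2⁻¹ : ℝ≥0∞) ^ (e * L) * X (k + e)
        ≤ 2⁻¹ ^ (e * L) * (C * ∑' d : ℕ, 2⁻¹ ^ (d * (L + 1))
            * (ε * X (k + e + d) + δ * W (k + e + d))) := by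
          gcongr
          refine (h _).trans ?_
          gcongr
          exact hy _ _
      -- Of the decay 2^{-d(L+1)}, the part 2^{-dL} completes the weight in S and T, and 2^{-d} is
      -- kept to sum over d.
      _ = C * ∑' d : ℕ, (ε * (2⁻¹ ^ d * (2⁻¹ ^ ((e + d) * L) * X (k + (e + d))))
            + δ * (2⁻¹ ^ d * (2⁻¹ ^ ((e + d) * L) * W (k + (e + d))))) := by
          rw [mul_left_comm, ← ENNReal.tsum_mul_left]
          congr 2; funext d
          rw [add_mul, mul_add d, mul_one, pow_add, pow_add, add_assoc]
          ring
      _ ≤ C * ∑' d : ℕ, (ε * (2⁻¹ ^ d * S)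
            + δ * (1 * (2⁻¹ ^ ((e + d) * L) * W (k + (e + d))))) := by
          gcongr with d
          · exact le_iSup (fun e : ℕ => (2⁻¹ : ℝ≥0∞) ^ (e * L) * X (k + e)) (e + d)
          · exact pow_le_one' (by simp) d
      _ ≤ C * (ε * (2 * S) + δ * T) := by
          rw [ENNReal.tsum_add, ENNReal.tsum_mul_left, ENNReal.tsum_mul_right, tsum_two_inv_pow,
            ENNReal.tsum_mul_left]
          simp only [one_mul]
          gcongr
          exact ENNReal.tsum_comp_le_tsum_of_injective (add_right_injective e)
            fun d : ℕ => (2⁻¹ : ℝ≥0∞) ^ (d * L) * W (k + d)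
      _ = C * ε * 2 * S + C * δ * T := by ring
      _ ≤ _ := by gcongr
  have hhalf : S ≤ 2 * (C * δ) * T := by
    have h1 : 2⁻¹ * S + 2⁻¹ * S = S := by
      rw [← add_mul, ENNReal.inv_two_add_inv_two, one_mul]
    have h2 : 2⁻¹ * S ≤ C * δ * T := by
      refine ENNReal.le_of_add_le_add_left (a := 2⁻¹ * S) (by finiteness) ?_
      rw [h1]; exact hle
    calc S = 2 * (2⁻¹ * S) := by
          rw [← mul_assoc, ENNReal.mul_inv_cancel two_ne_zero (by simp), one_mul]
      _ ≤ 2 * (C * δ * T) := by gcongr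
      _ = _ := by ring
  refine le_trans ?_ hhalf
  simpa using le_iSup (fun e : ℕ => (2⁻¹ : ℝ≥0∞) ^ (e * L) * X (k + e)) 0

theorem tsum_tsum_two_inv_pow_mul_le (U : ℕ → ℝ≥0∞) :
    ∑' k : ℕ, ∑' d : ℕ, (2⁻¹ : ℝ≥0∞) ^ d * U (k + d) ≤ 2 * ∑' j, U j := by
  rw [ENNReal.tsum_comm]
  calc ∑' d : ℕ, ∑' k : ℕ, (2⁻¹ : ℝ≥0∞) ^ d * U (k + d) ≤ ∑' d : ℕ, 2⁻¹ ^ d * ∑' j, U j := by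
        refine ENNReal.tsum_le_tsum fun d => ?_
        rw [ENNReal.tsum_mul_left]
        exact mul_le_mul' le_rfl
          (ENNReal.tsum_comp_le_tsum_of_injective (add_left_injective d) U)
    _ = _ := by rw [ENNReal.tsum_mul_right, tsum_two_inv_pow]

variable {Ω : Type*} [MeasurableSpace Ω] {ν : Measure Ω}

theorem eLpNorm_rpow_toReal {F : Ω → ℝ≥0∞} {θ : ℝ≥0∞} (h0 : θ ≠ 0) (ht : θ ≠ ∞) :
    eLpNorm F θ ν ^ θ.toReal = ∫⁻ x, F x ^ θ.toReal ∂ν := by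
  rw [eLpNorm_eq_lintegral_rpow_enorm_toReal h0 ht, ← ENNReal.rpow_mul, one_div,
    inv_mul_cancel₀ (ENNReal.toReal_pos h0 ht).ne', ENNReal.rpow_one]
  simp

/-- Interpolation between `L_θ` and the bounded functions, in a form homogeneous in `a`. -/
theorem eLpNorm_le_rpow_mul_add {F : Ω → ℝ≥0∞} {X : ℝ≥0∞} (hX : ∀ x, F x ≤ X) (hXt : X ≠ ∞) {θ r : ℝ≥0∞}
    (hθ : 0 < θ) (hθr : θ ≤ r) {a : ℝ≥0∞} (ha : a ≠ 0) (ha' : a ≠ ∞) :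
    eLpNorm F r ν ≤ a ^ ((θ⁻¹).toReal - (r⁻¹).toReal) * eLpNorm F θ ν
      + a ^ (-(r⁻¹).toReal) * X := by
  rcases eq_or_ne r ∞ with rfl | hr
  · simp only [ENNReal.inv_top, ENNReal.toReal_zero, neg_zero, ENNReal.rpow_zero, one_mul]
    refine le_trans ?_ le_add_self
    rw [eLpNorm_exponent_top]
    exact essSup_le_of_ae_le X (Filter.Eventually.of_forall hX)
  have hθt : θ ≠ ∞ := ne_top_of_le_ne_top hr hθr
  have hr0 : 0 < r := hθ.trans_le hθr
  set τ := θ.toReal with hτ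
  set u := r.toReal with hu
  have hτ0 : 0 < τ := ENNReal.toReal_pos hθ.ne' hθt
  have hu0 : 0 < u := ENNReal.toReal_pos hr0.ne' hr
  have hτu : τ ≤ u := ENNReal.toReal_mono hr hθr
  rw [ENNReal.toReal_inv, ENNReal.toReal_inv, ← hτ, ← hu]
  set Y := eLpNorm F θ ν
  have hl : τ / u ≤ 1 := (div_le_one hu0).mpr hτu
  have hl0 : 0 ≤ τ / u := by positivity
  -- The usual interpolation, from F^r ≤ X^{r-θ} F^θ.
  have h1 : eLpNorm F r ν ≤ X ^ (1 - τ / u) * Y ^ (τ / u) := by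
    have h2 : eLpNorm F r ν ^ u ≤ X ^ (u - τ) * Y ^ τ := by
      rw [eLpNorm_rpow_toReal hr0.ne' hr, eLpNorm_rpow_toReal hθ.ne' hθt, ← hτ, ← hu]
      rw [← lintegral_const_mul' _ _ (ENNReal.rpow_ne_top_of_nonneg (by linarith) hXt)]
      refine lintegral_mono fun x => ?_
      calc F x ^ u = F x ^ (u - τ) * F x ^ τ := by
            rw [← ENNReal.rpow_add_of_nonneg _ _ (by linarith) hτ0.le, sub_add_cancel]
        _ ≤ _ := by
            refine mul_le_mul_left (ENNReal.rpow_le_rpow (hX x) (by linarith)) _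
    calc eLpNorm F r ν = (eLpNorm F r ν ^ u) ^ u⁻¹ := by
          rw [← ENNReal.rpow_mul, mul_inv_cancel₀ hu0.ne', ENNReal.rpow_one]
      _ ≤ (X ^ (u - τ) * Y ^ τ) ^ u⁻¹ := by gcongr
      _ = _ := by
          rw [ENNReal.mul_rpow_of_nonneg _ _ (by positivity), ← ENNReal.rpow_mul,
            ← ENNReal.rpow_mul]
          congr 2
          field_simp
  set b := a ^ (τ⁻¹ - u⁻¹) * Y
  set c := a ^ (-u⁻¹) * X
  calc eLpNorm F r ν ≤ X ^ (1 - τ / u) * Y ^ (τ / u) := h1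
    -- The powers of a in b and c are chosen to cancel in this product.
    _ = c ^ (1 - τ / u) * b ^ (τ / u) := by
      simp only [b, c]
      rw [ENNReal.mul_rpow_of_nonneg _ _ (by linarith), ENNReal.mul_rpow_of_nonneg _ _ hl0,
        ← ENNReal.rpow_mul, ← ENNReal.rpow_mul, mul_mul_mul_comm, ← ENNReal.rpow_add _ _ ha ha']
      have : -u⁻¹ * (1 - τ / u) + (τ⁻¹ - u⁻¹) * (τ / u) = 0 := by field_simp; ring
      rw [this, ENNReal.rpow_zero, one_mul]
    _ ≤ (b + c) ^ (1 - τ / u) * (b + c) ^ (τ / u) := by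
      exact mul_le_mul' (ENNReal.rpow_le_rpow le_add_self (by linarith))
        (ENNReal.rpow_le_rpow le_self_add hl0)
    _ = b + c := by
      rw [← ENNReal.rpow_add_of_nonneg _ _ (by linarith) hl0, sub_add_cancel, ENNReal.rpow_one]

/-- The mean of a bounded function over a set of small measure, in terms of its `L_θ` norm. -/
theorem mul_setLIntegral_le {F : Ω → ℝ≥0∞} (hF : AEStronglyMeasurable F ν) {X : ℝ≥0∞}
    (hX : ∀ x, F x ≤ X) (hXt : X ≠ ∞) {θ : ℝ≥0∞} (hθ : 0 < θ) {a V : ℝ≥0∞} (ha : a ≠ 0)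
    (ha' : a ≠ ∞) (hV : 1 ≤ V) {B : Set Ω} (hB : ν B ≤ V * a⁻¹) :
    a * ∫⁻ x in B, F x ∂ν ≤ V * (X ^ (1 - (min 1 θ).toReal)
      * (a ^ (θ⁻¹).toReal * eLpNorm F θ ν) ^ (min 1 θ).toReal) := by
  rcases le_total θ 1 with h | h
  · rw [min_eq_right h]
    have ht : θ ≠ ∞ := ne_top_of_le_ne_top (by simp) h
    set τ := θ.toReal
    have hτ0 : 0 < τ := ENNReal.toReal_pos hθ.ne' ht
    have hτ1 : τ ≤ 1 := by simpa using ENNReal.toReal_mono (by simp) h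
    calc a * ∫⁻ x in B, F x ∂ν ≤ a * ∫⁻ x, X ^ (1 - τ) * F x ^ τ ∂ν := by
          refine mul_le_mul_right ?_ _
          refine (setLIntegral_le_lintegral _ _).trans (lintegral_mono fun x => ?_)
          calc F x = F x ^ (1 - τ) * F x ^ τ := by
                rw [← ENNReal.rpow_add_of_nonneg _ _ (by linarith) hτ0.le, sub_add_cancel,
                  ENNReal.rpow_one]
            _ ≤ _ := by
              exact mul_le_mul_left (ENNReal.rpow_le_rpow (hX x) (by linarith)) _
      _ = X ^ (1 - τ) * (a ^ (θ⁻¹).toReal * eLpNorm F θ ν) ^ τ := by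
          rw [lintegral_const_mul' _ _ (ENNReal.rpow_ne_top_of_nonneg (by linarith) hXt),
            ← eLpNorm_rpow_toReal hθ.ne' ht, ENNReal.mul_rpow_of_nonneg _ _ hτ0.le,
            ← ENNReal.rpow_mul, ENNReal.toReal_inv, inv_mul_cancel₀ hτ0.ne', ENNReal.rpow_one]
          ring
      _ ≤ _ := le_mul_of_one_le_left zero_le hV
  · rw [min_eq_left h]
    simp only [ENNReal.toReal_one, sub_self, ENNReal.rpow_zero, one_mul, ENNReal.rpow_one]
    -- For θ ≥ 1, Hölder on the small set B suffices. For θ ≤ 1, above, F ≤ X^{1-θ} F^θ was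
    -- integrated over the whole space.
    have h1 : ∫⁻ x in B, F x ∂ν ≤ eLpNorm F θ ν * (V * a⁻¹) ^ (1 - (θ⁻¹).toReal) := by
      have h2 := eLpNorm_le_eLpNorm_mul_rpow_measure_univ (μ := ν.restrict B) h hF.restrict
      rw [eLpNorm_one_eq_lintegral_enorm] at h2
      have h3 : (θ⁻¹).toReal ≤ 1 := by
        simpa using ENNReal.toReal_mono (by simp) (ENNReal.inv_le_one.mpr h)
      simp only [enorm_eq_self, Measure.restrict_apply_univ, ENNReal.toReal_one, div_one] at h2
      refine h2.trans ?_
      rw [one_div, ← ENNReal.toReal_inv]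
      gcongr
      exact Measure.restrict_le_self
    have h3 : (θ⁻¹).toReal ≤ 1 := by
      simpa using ENNReal.toReal_mono (by simp) (ENNReal.inv_le_one.mpr h)
    set t := (θ⁻¹).toReal
    have ht0 : 0 ≤ t := ENNReal.toReal_nonneg
    calc a * ∫⁻ x in B, F x ∂ν ≤ a * (eLpNorm F θ ν * (V * a⁻¹) ^ (1 - t)) := by gcongr
      _ = V ^ (1 - t) * (a * a⁻¹ ^ (1 - t) * eLpNorm F θ ν) := by
        rw [ENNReal.mul_rpow_of_nonneg _ _ (by linarith)]; ring
      _ = V ^ (1 - t) * (a ^ t * eLpNorm F θ ν) := by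
        congr 2
        nth_rewrite 1 [← ENNReal.rpow_one a]
        rw [ENNReal.inv_rpow, ← ENNReal.rpow_neg, ← ENNReal.rpow_add _ _ ha ha']
        congr 1; ring
      _ ≤ _ := by
        gcongr
        calc V ^ (1 - t) ≤ V ^ (1 : ℝ) := ENNReal.rpow_le_rpow_of_exponent_le hV (by linarith)
          _ = V := ENNReal.rpow_one V

end Inequalities

/-! ### Pointwise bounds by local means and the Nikol'skii type inequality -/

section LocalMeans

open Filter Topology

variable {𝕜 : Type*} [RCLike 𝕜] {n : ℕ}

/-- The function `x ↦ |(φ_j * f) (x)| exp (-R |x|)`. -/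
def wconv (φ₀ : Test 𝕜 n) (f : Distr 𝕜 n) (R : ℝ) (j : ℕ) (x : Rn n) : ℝ≥0∞ :=
  ‖conv (phiSeq φ₀ j) f x‖ₑ * ENNReal.ofReal (Real.exp (-R * ‖x‖))

theorem IsExpDistr.continuous_wconv {f : Distr 𝕜 n} (hf : IsExpDistr f) (φ₀ : Test 𝕜 n) (R : ℝ)
    (j : ℕ) : Continuous (wconv φ₀ f R j) := by
  have h1 : wconv φ₀ f R j = fun x =>
      ENNReal.ofReal (‖conv (phiSeq φ₀ j) f x‖ * Real.exp (-R * ‖x‖)) := by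
    funext x
    rw [wconv, ENNReal.ofReal_mul (norm_nonneg _), ofReal_norm]
  have := hf.continuous_conv (phiSeq φ₀ j)
  rw [h1]
  exact ENNReal.continuous_ofReal.comp (by fun_prop)

theorem IsExpDistr.enorm_conv_phiSeq_le {f : Distr 𝕜 n} (hf : IsExpDistr f) {φ₀ : Test 𝕜 n}
    (h1 : ∫ x, φ₀ x = 1) (L k : ℕ) (x : Rn n) :
    ‖conv (phiSeq φ₀ k) f x‖ₑ
      ≤ ∑' d, ‖∫ y, kern φ₀ L k d y * conv (phiSeq φ₀ (k + d)) f (x - y)‖ₑ := by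
  have h2 : ∀ D, conv (phiSeq φ₀ k) f x
      - conv ((Test.errL (Test.dyadic (D + k) φ₀) ^ (L + 1)) (phiSeq φ₀ k)) f x
      = ∑ d ∈ Finset.range (D + 1),
        ∫ y, kern φ₀ L k d y * conv (phiSeq φ₀ (k + d)) f (x - y) := by
    intro D
    have := congrArg (fun g => conv g f x) (phiSeq_eq_sum_cv_kern φ₀ L k D)
    simp only [conv_add, conv_sum, hf.conv_cv] at this
    rw [sub_eq_iff_eq_add, add_comm D k]
    exact this
  have h3 := (((tendsto_add_atTop_iff_nat k).mpr
    (hf.tendsto_conv_errL_pow h1 (phiSeq φ₀ k) x L)).const_sub (conv (phiSeq φ₀ k) f x)).enorm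
  rw [sub_zero] at h3
  refine le_of_tendsto' h3 fun D => ?_
  rw [h2 D]
  exact (enorm_sum_le _ _).trans (ENNReal.sum_le_tsum _)

theorem IsExpDistr.exists_wconv_le_tsum {f : Distr 𝕜 n} (hf : IsExpDistr f) {φ₀ : Test 𝕜 n}
    (h1 : ∫ x, φ₀ x = 1) (L : ℕ) {R : ℝ} (hR : 0 ≤ R) :
    ∃ (C : ℝ≥0∞) (ρ : ℝ), C ≠ ∞ ∧ 0 < ρ ∧ ∀ k x, wconv φ₀ f R k x
      ≤ C * ∑' d : ℕ, 2⁻¹ ^ (d * L) * (2 ^ (k * n)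
        * ∫⁻ y in Metric.closedBall x (ρ / 2 ^ k), wconv φ₀ f R (k + d) y) := by
  obtain ⟨ρ, hρ, hs⟩ := exists_kern_suppIn φ₀ L
  obtain ⟨C, hC, hk⟩ := exists_norm_kern_le φ₀ h1 L
  set E := ENNReal.ofReal (Real.exp (R * ρ))
  refine ⟨ENNReal.ofReal C * E, ρ, by finiteness, hρ, fun k x => ?_⟩
  set r := ρ / 2 ^ k with hr
  have hrρ : r ≤ ρ := div_le_self hρ.le (one_le_pow₀ one_le_two)
  rw [wconv]
  calc ‖conv (phiSeq φ₀ k) f x‖ₑ * ENNReal.ofReal (Real.exp (-R * ‖x‖))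
      ≤ (∑' d, ‖∫ y, kern φ₀ L k d y * conv (phiSeq φ₀ (k + d)) f (x - y)‖ₑ)
          * ENNReal.ofReal (Real.exp (-R * ‖x‖)) := by
        gcongr; exact hf.enorm_conv_phiSeq_le h1 L k x
    _ = ∑' d, ‖∫ y, kern φ₀ L k d y * conv (phiSeq φ₀ (k + d)) f (x - y)‖ₑ
          * ENNReal.ofReal (Real.exp (-R * ‖x‖)) := ENNReal.tsum_mul_right.symm
    _ ≤ ∑' d : ℕ, (ENNReal.ofReal C * E) * (2⁻¹ ^ (d * L) * (2 ^ (k * n)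
          * ∫⁻ y in Metric.closedBall x r, wconv φ₀ f R (k + d) y)) := by
        refine ENNReal.tsum_le_tsum fun d => ?_
        set c : ℝ≥0∞ := ENNReal.ofReal C * 2 ^ (k * n) * 2⁻¹ ^ (d * L)
        have hkd : ∀ y, ‖kern φ₀ L k d y‖ₑ ≤ c := by
          intro y
          rw [← ofReal_norm]
          refine (ENNReal.ofReal_le_ofReal (hk k d y)).trans (le_of_eq ?_)
          rw [ENNReal.ofReal_mul (by positivity), ENNReal.ofReal_mul hC,
            ENNReal.ofReal_inv_of_pos (by positivity), ENNReal.ofReal_pow zero_le_two,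
            ENNReal.ofReal_pow zero_le_two, ENNReal.ofReal_ofNat, ENNReal.inv_pow]
        have hpt : ∀ y, ‖kern φ₀ L k d y * conv (phiSeq φ₀ (k + d)) f (x - y)‖ₑ
            * ENNReal.ofReal (Real.exp (-R * ‖x‖))
            ≤ c * E * (Metric.closedBall x r).indicator (wconv φ₀ f R (k + d)) (x - y) := by
          intro y
          by_cases hy : r < ‖y‖
          · simp [hs k d y hy]
          · rw [Set.indicator_of_mem (by
              rw [mem_closedBall_iff_norm, sub_sub_cancel_left, norm_neg]; exact not_lt.mp hy),
              wconv, enorm_mul]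
            -- The exponential weight changes by at most the factor exp(Rρ) within distance ρ, so it
            -- passes inside the local mean.
            have he : ENNReal.ofReal (Real.exp (-R * ‖x‖))
                ≤ E * ENNReal.ofReal (Real.exp (-R * ‖x - y‖)) := by
              rw [← ENNReal.ofReal_mul (Real.exp_nonneg _), ← Real.exp_add]
              refine ENNReal.ofReal_le_ofReal (Real.exp_le_exp.mpr ?_)
              have : ‖x - y‖ ≤ ‖x‖ + ρ := (norm_sub_le _ _).trans (by linarith)
              nlinarith
            calc _ ≤ c * ‖conv (phiSeq φ₀ (k + d)) f (x - y)‖ₑ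
                  * (E * ENNReal.ofReal (Real.exp (-R * ‖x - y‖))) := by
                  gcongr; exact hkd y
              _ = _ := by ring
        calc _ ≤ (∫⁻ y, ‖kern φ₀ L k d y * conv (phiSeq φ₀ (k + d)) f (x - y)‖ₑ)
                * ENNReal.ofReal (Real.exp (-R * ‖x‖)) := by
              gcongr; exact enorm_integral_le_lintegral_enorm _
          _ = ∫⁻ y, ‖kern φ₀ L k d y * conv (phiSeq φ₀ (k + d)) f (x - y)‖ₑ
                * ENNReal.ofReal (Real.exp (-R * ‖x‖)) :=
              (lintegral_mul_const' _ _ ENNReal.ofReal_ne_top).symm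
          _ ≤ ∫⁻ y, c * E * (Metric.closedBall x r).indicator (wconv φ₀ f R (k + d)) (x - y) :=
              lintegral_mono hpt
          _ = c * E * ∫⁻ y, (Metric.closedBall x r).indicator (wconv φ₀ f R (k + d)) (x - y) :=
              lintegral_const_mul' _ _ (by finiteness)
          _ = c * E * ∫⁻ y in Metric.closedBall x r, wconv φ₀ f R (k + d) y := by
              rw [lintegral_sub_left_eq_self
                ((Metric.closedBall x r).indicator (wconv φ₀ f R (k + d))) x,
                lintegral_indicator Metric.isClosed_closedBall.measurableSet]
          _ = _ := by simp only [c]; ring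
    _ = _ := ENNReal.tsum_mul_left

/-- The a priori bound that makes absorption legitimate. The order N of f fixes both the rate of the
weight and the growth A = n + N in j. -/
theorem IsExpDistr.exists_wconv_le {f : Distr 𝕜 n} (hf : IsExpDistr f) (φ₀ : Test 𝕜 n) :
    ∃ (C : ℝ≥0∞) (N A : ℕ), C ≠ ∞ ∧ ∀ R : ℝ, N ≤ R → ∀ j x,
      wconv φ₀ f R j x ≤ C * 2 ^ (j * A) := by
  obtain ⟨C, N, hC, hb⟩ := hf.exists_bound
  obtain ⟨ρ, hρ, hφ⟩ := φ₀.exists_suppIn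
  choose D hD hDb using exists_pnorm_phiSeq_le φ₀
  set S := ∑ i ∈ Finset.range (N + 1), D i
  have hS : 0 ≤ S := Finset.sum_nonneg fun i _ => hD i
  refine ⟨ENNReal.ofReal (C * Real.exp (N * (2 * ρ)) * S), N, n + N, by finiteness,
    fun R hR j x => ?_⟩
  have h1 : ‖conv (phiSeq φ₀ j) f x‖ * Real.exp (-R * ‖x‖)
      ≤ C * Real.exp (N * (2 * ρ)) * S * 2 ^ (j * (n + N)) := by
    have h2 := norm_conv_le hC hb ((Test.SuppIn.phiSeq hρ.le hφ j).mono
      (div_le_self (by positivity) (one_le_pow₀ one_le_two))) x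
    have h3 : ∑ i ∈ Finset.range (N + 1), (phiSeq φ₀ j).pnorm i ≤ S * 2 ^ (j * (n + N)) := by
      rw [Finset.sum_mul]
      refine Finset.sum_le_sum fun i hi => (hDb i j).trans ?_
      have := Nat.lt_succ_iff.mp (Finset.mem_range.mp hi)
      gcongr
      · exact hD i
      · exact one_le_two
    have h4 : Real.exp (N * (2 * ρ + ‖x‖)) * Real.exp (-R * ‖x‖) ≤ Real.exp (N * (2 * ρ)) := by
      rw [← Real.exp_add]
      refine Real.exp_le_exp.mpr ?_
      nlinarith [norm_nonneg x]
    calc _ ≤ C * Real.exp (N * (2 * ρ + ‖x‖)) * (S * 2 ^ (j * (n + N)))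
          * Real.exp (-R * ‖x‖) := by gcongr; exact h2.trans (by gcongr)
      _ = C * (Real.exp (N * (2 * ρ + ‖x‖)) * Real.exp (-R * ‖x‖))
          * (S * 2 ^ (j * (n + N))) := by ring
      _ ≤ C * Real.exp (N * (2 * ρ)) * (S * 2 ^ (j * (n + N))) := by gcongr
      _ = _ := by ring
  rw [wconv, ← ofReal_norm, ← ENNReal.ofReal_mul (norm_nonneg _)]
  refine (ENNReal.ofReal_le_ofReal h1).trans (le_of_eq ?_)
  rw [ENNReal.ofReal_mul (by positivity), ENNReal.ofReal_pow zero_le_two, ENNReal.ofReal_ofNat]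

theorem volume_closedBall_div_two_pow_le (ρ : ℝ) (hρ : 0 ≤ ρ) :
    ∃ V : ℝ≥0∞, 1 ≤ V ∧ V ≠ ∞ ∧ ∀ (k : ℕ) (x : Rn n),
      volume (Metric.closedBall x (ρ / 2 ^ k)) ≤ V * (2 ^ (k * n))⁻¹ := by
  have hfin : volume (Metric.ball (0 : Rn n) 1) ≠ ∞ := measure_ball_lt_top.ne
  refine ⟨1 + ENNReal.ofReal (ρ ^ n) * volume (Metric.ball (0 : Rn n) 1), le_self_add,
    by finiteness, fun k x => ?_⟩
  rw [Measure.addHaar_closedBall _ _ (by positivity), finrank_euclideanSpace_fin, div_pow,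
    ENNReal.ofReal_div_of_pos (by positivity), ← pow_mul,
    ENNReal.ofReal_pow (p := 2) zero_le_two, ENNReal.ofReal_ofNat, div_eq_mul_inv, mul_right_comm]
  gcongr
  exact le_add_self

/-- Moving the power 2^{-knu} from level k to level k + d costs 2^{dnu} ≤ 2^{dn}; L ≥ n + 1 pays for
it and leaves 2^{-d}. -/
theorem two_pow_rpow_neg_mul_le {n L : ℕ} (k d : ℕ) (hL : n + 1 ≤ L) {u : ℝ}
    (hu1 : u ≤ 1) (t : ℝ) (y : ℝ≥0∞) :
    ((2 : ℝ≥0∞) ^ (k * n)) ^ (-u) * (2⁻¹ ^ (d * L) * ((2 ^ ((k + d) * n)) ^ t * y))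
      ≤ 2⁻¹ ^ d * ((2 ^ ((k + d) * n)) ^ (t - u) * y) := by
  obtain ⟨a, ha⟩ : ∃ a : ℕ → ℝ≥0∞, ∀ j, a j = 2 ^ (j * n) := ⟨_, fun _ => rfl⟩
  have ha0 : ∀ j, a j ≠ 0 := fun j => by simp [ha]
  have hat : ∀ j, a j ≠ ∞ := fun j => by simp [ha]
  rw [← ha, ← ha]
  have e1 : a (k + d) = a d * a k := by rw [ha, ha, ha, ← pow_add]; congr 1; ring
  have e2 : a k ^ (-u) = a d ^ u * a (k + d) ^ (-u) := by
    rw [e1, ENNReal.mul_rpow_of_ne_top (hat d) (hat k), ← mul_assoc,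
      ← ENNReal.rpow_add _ _ (ha0 d) (hat d), add_neg_cancel, ENNReal.rpow_zero, one_mul]
  have e3 : a (k + d) ^ (t - u) = a (k + d) ^ (-u) * a (k + d) ^ t := by
    rw [← ENNReal.rpow_add _ _ (ha0 _) (hat _)]; congr 1; ring
  have e4 : a d ^ u * 2⁻¹ ^ (d * L) ≤ 2⁻¹ ^ d := by
    calc a d ^ u * 2⁻¹ ^ (d * L) ≤ a d ^ (1 : ℝ) * 2⁻¹ ^ (d * (n + 1)) := by
          refine mul_le_mul' (ENNReal.rpow_le_rpow_of_exponent_le ?_ hu1) ?_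
          · rw [ha]; exact one_le_pow₀ one_le_two
          · exact pow_le_pow_right_of_le_one' (by simp) (Nat.mul_le_mul_left d hL)
      _ = (2 ^ (d * n) * 2⁻¹ ^ (d * n)) * 2⁻¹ ^ d := by
          rw [ENNReal.rpow_one, ha, mul_add, pow_add, mul_one, mul_assoc]
      _ = 2⁻¹ ^ d := by
          rw [← mul_pow, ENNReal.mul_inv_cancel two_ne_zero (by simp), one_pow, one_mul]
  rw [e2, e3]
  calc _ = a d ^ u * 2⁻¹ ^ (d * L) * (a (k + d) ^ (-u) * a (k + d) ^ t * y) := by ring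
    _ ≤ _ := by gcongr

/-- The Nikol'skii type inequality: the `L_r` norms of the functions `φ_k * f` (with an exponential
weight) are controlled by the `L_θ` norms of the functions `φ_j * f`, `j ≥ k`. -/
theorem IsExpDistr.exists_eLpNorm_wconv_le {f : Distr 𝕜 n} (hf : IsExpDistr f) {φ₀ : Test 𝕜 n}
    (h1 : ∫ x, φ₀ x = 1) {θ r : ℝ≥0∞} (hθ : 0 < θ) (hθr : θ ≤ r) (hr : 1 ≤ r) :
    ∃ N : ℕ, ∀ R : ℝ, N ≤ R → ∃ C : ℝ≥0∞, C ≠ ∞ ∧ ∀ k, eLpNorm (wconv φ₀ f R k) r volume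
      ≤ C * ∑' d : ℕ, 2⁻¹ ^ d * ((2 ^ ((k + d) * n)) ^ ((θ⁻¹).toReal - (r⁻¹).toReal)
        * eLpNorm (wconv φ₀ f R (k + d)) θ volume) := by
  obtain ⟨C₀, N, A, hC₀, hA⟩ := hf.exists_wconv_le φ₀
  refine ⟨N, fun R hR => ?_⟩
  -- A ≤ L is for the absorption, n + 1 ≤ L for the change of level from k to k + d. The kernels are
  -- taken with L + 1.
  obtain ⟨L, hAL, hnL⟩ : ∃ L, A ≤ L ∧ n + 1 ≤ L :=
    ⟨max A (n + 1), le_max_left _ _, le_max_right _ _⟩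
  obtain ⟨C, ρ, hC, hρ, hle⟩ := hf.exists_wconv_le_tsum h1 (L + 1)
    ((Nat.cast_nonneg N).trans hR)
  obtain ⟨V, hV, hVt, hvol⟩ := volume_closedBall_div_two_pow_le (n := n) ρ hρ.le
  set a : ℕ → ℝ≥0∞ := fun j => 2 ^ (j * n) with ha
  have ha0 : ∀ j, a j ≠ 0 := fun j => by simp [ha]
  have hat : ∀ j, a j ≠ ∞ := fun j => by simp [ha]
  set t := (θ⁻¹).toReal
  set u := (r⁻¹).toReal
  have ht0 : 0 ≤ t := ENNReal.toReal_nonneg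
  have hu0 : 0 ≤ u := ENNReal.toReal_nonneg
  have hu1 : u ≤ 1 := by
    simpa [u] using ENNReal.toReal_mono (by simp) (ENNReal.inv_le_one.mpr hr)
  set Y : ℕ → ℝ≥0∞ := fun j => eLpNorm (wconv φ₀ f R j) θ volume
  set X : ℕ → ℝ≥0∞ := fun j => ⨆ x, wconv φ₀ f R j x
  have hX : ∀ j, X j ≤ C₀ * 2 ^ (j * A) := fun j => iSup_le fun x => hA R hR j x
  have hXt : ∀ j, X j ≠ ∞ := fun j => ne_top_of_le_ne_top (by finiteness) (hX j)
  have hXx : ∀ j x, wconv φ₀ f R j x ≤ X j := fun j x => le_iSup (wconv φ₀ f R j) x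
  set s := (min 1 θ).toReal
  have hmt : min 1 θ ≠ ∞ := ne_top_of_le_ne_top (by simp) (min_le_left 1 θ)
  have hs : 0 < s := ENNReal.toReal_pos (lt_min one_pos hθ).ne' hmt
  have hs1 : s ≤ 1 := by simpa using ENNReal.toReal_mono (by simp) (min_le_left 1 θ)
  have hXW : ∀ k, X k ≤ (C * V) * ∑' d : ℕ, 2⁻¹ ^ (d * (L + 1))
      * (X (k + d) ^ (1 - s) * (a (k + d) ^ t * Y (k + d)) ^ s) := by
    refine fun k => iSup_le fun x => (hle k x).trans ?_
    rw [mul_assoc, ← ENNReal.tsum_mul_left (a := V)]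
    refine mul_le_mul' le_rfl (ENNReal.tsum_le_tsum fun d => ?_)
    rw [mul_left_comm V]
    refine mul_le_mul' le_rfl ((mul_setLIntegral_le
      (hf.continuous_wconv φ₀ R (k + d)).aestronglyMeasurable (hXx (k + d)) (hXt (k + d)) hθ
      (ha0 k) (hat k) hV (hvol k x)).trans ?_)
    have : a k ≤ a (k + d) := pow_le_pow_right₀ one_le_two (Nat.mul_le_mul_right n (by simp))
    gcongr
  obtain ⟨C', hC', hXC⟩ := exists_le_tsum_of_le_tsum_rpow_mul
    (W := fun j => a j ^ t * Y j) hs hs1 (ENNReal.mul_ne_top hC hVt) hC₀ hAL hX hXW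
  refine ⟨1 + C', by finiteness, fun k => ?_⟩
  refine (eLpNorm_le_rpow_mul_add (hXx k) (hXt k) hθ hθr (ha0 k) (hat k)).trans ?_
  rw [add_mul, one_mul]
  -- Interpolation with a = 2^{kn}: its L_θ part is the term d = 0 of the sum, its sup part is
  -- bounded by the absorbed estimate.
  refine add_le_add ?_ ?_
  · refine le_trans ?_ (ENNReal.le_tsum 0)
    simp [a, t, u]
  · calc a k ^ (-u) * X k
        ≤ a k ^ (-u) * (C' * ∑' d : ℕ, 2⁻¹ ^ (d * L) * (a (k + d) ^ t * Y (k + d))) := by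
          gcongr; exact hXC k
      _ = C' * ∑' d : ℕ, a k ^ (-u) * (2⁻¹ ^ (d * L) * (a (k + d) ^ t * Y (k + d))) := by
          rw [mul_left_comm, ENNReal.tsum_mul_left]
      _ ≤ _ := mul_le_mul' le_rfl (ENNReal.tsum_le_tsum fun d =>
          two_pow_rpow_neg_mul_le k d hnL hu1 t (Y (k + d)))

end LocalMeans

/-! ### Unit cubes and exponential weights -/

section UnitCubes

open Filter Topology

variable {n : ℕ}

theorem mem_dyadicCube_zero {m : Fin n → ℤ} {x : Rn n} :
    x ∈ dyadicCube 0 m ↔ ∀ i, (m i : ℝ) < x i ∧ x i < m i + 1 := by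
  simp [dyadicCube]

theorem dyadicCube_zero_eq_preimage (m : Fin n → ℤ) :
    dyadicCube 0 m = (WithLp.ofLp : Rn n → Fin n → ℝ) ⁻¹'
      (Set.univ.pi fun i => Set.Ioo (m i : ℝ) (m i + 1)) := by
  ext x; simp [mem_dyadicCube_zero]

theorem measurableSet_dyadicCube_zero (m : Fin n → ℤ) : MeasurableSet (dyadicCube 0 m) := by
  rw [dyadicCube_zero_eq_preimage]
  exact (PiLp.volume_preserving_ofLp (Fin n)).measurable
    (MeasurableSet.univ_pi fun _ => measurableSet_Ioo)

theorem volume_dyadicCube_zero (m : Fin n → ℤ) : volume (dyadicCube 0 m) = 1 := by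
  rw [dyadicCube_zero_eq_preimage, (PiLp.volume_preserving_ofLp (Fin n)).measure_preimage
    (MeasurableSet.univ_pi fun _ => measurableSet_Ioo).nullMeasurableSet, Real.volume_pi_Ioo]
  simp

theorem pairwise_disjoint_dyadicCube_zero :
    Pairwise (Function.onFun Disjoint fun m : Fin n → ℤ => dyadicCube 0 m) := by
  intro m m' hne
  refine Set.disjoint_left.mpr fun x hx hx' => hne (funext fun i => ?_)
  have h1 := mem_dyadicCube_zero.mp hx i
  have h2 := mem_dyadicCube_zero.mp hx' i
  have h3 : (m i : ℝ) < m' i + 1 := h1.1.trans h2.2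
  have h4 : (m' i : ℝ) < m i + 1 := h2.1.trans h1.2
  norm_cast at h3 h4
  omega

theorem ae_mem_iUnion_dyadicCube_zero :
    ∀ᵐ x ∂(volume : Measure (Rn n)), x ∈ ⋃ m : Fin n → ℤ, dyadicCube 0 m := by
  have h1 : ∀ i : Fin n, ∀ᵐ x ∂(volume : Measure (Rn n)),
      x i ∉ Set.range (Int.cast : ℤ → ℝ) := by
    intro i
    have h2 : ∀ᵐ y : ℝ, y ∉ Set.range (Int.cast : ℤ → ℝ) :=
      (Set.countable_range _).ae_notMem volume
    have h3 : ∀ᵐ y ∂(volume : Measure (Fin n → ℝ)), y i ∉ Set.range (Int.cast : ℤ → ℝ) :=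
      (Measure.quasiMeasurePreserving_eval (μ := fun _ : Fin n => (volume : Measure ℝ)) i).ae h2
    exact (PiLp.volume_preserving_ofLp (Fin n)).quasiMeasurePreserving.ae h3
  filter_upwards [ae_all_iff.mpr h1] with x hx
  refine Set.mem_iUnion.mpr ⟨fun i => ⌊x i⌋, mem_dyadicCube_zero.mpr fun i => ⟨?_, ?_⟩⟩
  · exact lt_of_le_of_ne (Int.floor_le _) fun h => hx i ⟨_, h⟩
  · exact Int.lt_floor_add_one _

theorem norm_sub_le_of_mem_dyadicCube_zero {m : Fin n → ℤ} {x y : Rn n}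
    (hx : x ∈ dyadicCube 0 m) (hy : y ∈ dyadicCube 0 m) : ‖x - y‖ ≤ n := by
  rw [EuclideanSpace.norm_eq]
  refine Real.sqrt_le_iff.mpr ⟨by positivity, ?_⟩
  have h1 : ∑ i, ‖(x - y) i‖ ^ 2 ≤ ∑ _i : Fin n, (1 : ℝ) := by
    refine Finset.sum_le_sum fun i _ => ?_
    have h2 := mem_dyadicCube_zero.mp hx i
    have h3 := mem_dyadicCube_zero.mp hy i
    rw [Real.norm_eq_abs, sq_abs, PiLp.sub_apply]
    nlinarith
  refine h1.trans ?_
  rw [Finset.sum_const, Finset.card_univ, Fintype.card_fin, nsmul_eq_mul, mul_one]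
  rcases Nat.eq_zero_or_pos n with h | h
  · simp [h]
  · exact le_self_pow₀ (by exact_mod_cast h) two_ne_zero

theorem lintegral_exp_neg_mul_norm_lt_top {τ : ℝ} (hτ : 0 < τ) :
    ∫⁻ x : Rn n, ENNReal.ofReal (Real.exp (-τ * ‖x‖)) < ∞ := by
  have h1 : Integrable (fun x : Rn n => (1 + ‖x‖) ^ (-((n + 1 : ℕ) : ℝ))) volume :=
    integrable_one_add_norm (by rw [finrank_euclideanSpace_fin]; push_cast; linarith)
  set K := Real.exp τ * ((n + 1).factorial / τ ^ (n + 1))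
  have h2 := (h1.const_mul K).lintegral_lt_top
  refine lt_of_le_of_lt (lintegral_mono fun x => ENNReal.ofReal_le_ofReal ?_) h2
  have hz : 0 < 1 + ‖x‖ := by positivity
  have h3 := Real.pow_div_factorial_le_exp _ (mul_pos hτ hz).le (n + 1)
  rw [Real.rpow_neg hz.le, Real.rpow_natCast]
  have h4 : Real.exp (-τ * ‖x‖) = Real.exp τ * (Real.exp (τ * (1 + ‖x‖)))⁻¹ := by
    rw [← Real.exp_neg, ← Real.exp_add]; congr 1; ring
  rw [h4, mul_assoc]
  refine mul_le_mul_of_nonneg_left ?_ (Real.exp_nonneg _)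
  calc (Real.exp (τ * (1 + ‖x‖)))⁻¹ ≤ ((τ * (1 + ‖x‖)) ^ (n + 1) / (n + 1).factorial)⁻¹ := by
        gcongr
    _ = _ := by rw [inv_div, mul_pow]; field_simp

/-- Uniform bounds for the `L_θ` norms over the unit cubes give a bound for the `L_θ` norm with an
exponential weight. -/
theorem exists_eLpNorm_mul_exp_le {θ : ℝ≥0∞} (hθ : 0 < θ) :
    ∃ C : ℝ≥0∞, C ≠ ∞ ∧ ∀ (H : Rn n → ℝ≥0∞) (B : ℝ≥0∞),
      (∀ m, eLpNorm H θ (volume.restrict (dyadicCube 0 m)) ≤ B) →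
      eLpNorm (fun x => H x * ENNReal.ofReal (Real.exp (-‖x‖))) θ volume ≤ C * B := by
  rcases eq_or_ne θ ∞ with rfl | ht
  · refine ⟨1, by simp, fun H B hB => ?_⟩
    rw [eLpNorm_exponent_top, one_mul]
    refine essSup_le_of_ae_le B ?_
    have h1 : ∀ m, ∀ᵐ x ∂(volume : Measure (Rn n)), x ∈ dyadicCube 0 m → H x ≤ B := by
      intro m
      rw [← ae_restrict_iff' (measurableSet_dyadicCube_zero m)]
      have h2 := hB m
      rw [eLpNorm_exponent_top] at h2
      filter_upwards [ENNReal.ae_le_essSup (μ := volume.restrict (dyadicCube 0 m))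
        fun x => ‖H x‖ₑ] with x hx
      exact hx.trans h2
    filter_upwards [ae_all_iff.mpr h1, ae_mem_iUnion_dyadicCube_zero] with x hx hxm
    obtain ⟨m, hm⟩ := Set.mem_iUnion.mp hxm
    calc H x * ENNReal.ofReal (Real.exp (-‖x‖)) ≤ B * 1 := by
          gcongr
          · exact hx m hm
          · rw [ENNReal.ofReal_le_one]; exact Real.exp_le_one_iff.mpr (by simp)
      _ = B := mul_one B
  · set τ := θ.toReal
    have hτ : 0 < τ := ENNReal.toReal_pos hθ.ne' ht
    set E : Rn n → ℝ≥0∞ := fun x => ENNReal.ofReal (Real.exp (-τ * ‖x‖)) with hE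
    set e := ENNReal.ofReal (Real.exp (τ * n))
    have hfin := lintegral_exp_neg_mul_norm_lt_top (n := n) hτ
    refine ⟨(e * ∫⁻ x, E x) ^ (1 / τ),
      ENNReal.rpow_ne_top_of_nonneg (by positivity) (by finiteness), fun H B hB => ?_⟩
    have hcube : ∀ m, ∫⁻ x in dyadicCube 0 m, H x ^ τ * E x
        ≤ B ^ τ * (e * ∫⁻ y in dyadicCube 0 m, E y) := by
      intro m
      -- On a cube of volume 1 and diameter at most n the weight is comparable to its mean, so the
      -- sum over the cubes becomes the integral of exp(-τ|x|).
      have h1 : ∀ x ∈ dyadicCube 0 m, E x ≤ e * ∫⁻ y in dyadicCube 0 m, E y := by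
        intro x hx
        rw [← lintegral_const_mul' _ _ ENNReal.ofReal_ne_top]
        calc E x = ∫⁻ _y in dyadicCube 0 m, E x := by
              rw [setLIntegral_const, volume_dyadicCube_zero, mul_one]
          _ ≤ _ := by
              refine setLIntegral_mono' (measurableSet_dyadicCube_zero m) fun y hy => ?_
              rw [hE, ← ENNReal.ofReal_mul (Real.exp_nonneg _), ← Real.exp_add]
              refine ENNReal.ofReal_le_ofReal (Real.exp_le_exp.mpr ?_)
              have h2 := norm_sub_le_of_mem_dyadicCube_zero hy hx
              have h3 := norm_sub_norm_le y x
              nlinarith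
      have hI : ∫⁻ y in dyadicCube 0 m, E y ≠ ∞ :=
        ((setLIntegral_le_lintegral _ _).trans_lt hfin).ne
      calc ∫⁻ x in dyadicCube 0 m, H x ^ τ * E x
          ≤ ∫⁻ x in dyadicCube 0 m, H x ^ τ * (e * ∫⁻ y in dyadicCube 0 m, E y) :=
            setLIntegral_mono' (measurableSet_dyadicCube_zero m) fun x hx =>
              mul_le_mul' le_rfl (h1 x hx)
        _ = (∫⁻ x in dyadicCube 0 m, H x ^ τ) * (e * ∫⁻ y in dyadicCube 0 m, E y) :=
            lintegral_mul_const' _ _ (by finiteness)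
        _ ≤ _ := by
            refine mul_le_mul' ?_ le_rfl
            rw [← eLpNorm_rpow_toReal hθ.ne' ht]
            exact ENNReal.rpow_le_rpow (hB m) hτ.le
    have hsum : ∫⁻ x, H x ^ τ * E x ≤ B ^ τ * (e * ∫⁻ x, E x) := by
      have hae : (volume : Measure (Rn n)) = volume.restrict (⋃ m : Fin n → ℤ, dyadicCube 0 m) :=
        (Measure.restrict_eq_self_of_ae_mem ae_mem_iUnion_dyadicCube_zero).symm
      calc ∫⁻ x, H x ^ τ * E x
          = ∫⁻ x in ⋃ m : Fin n → ℤ, dyadicCube 0 m, H x ^ τ * E x := by rw [← hae]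
        _ ≤ ∑' m : Fin n → ℤ, ∫⁻ x in dyadicCube 0 m, H x ^ τ * E x := lintegral_iUnion_le _ _
        _ ≤ ∑' m : Fin n → ℤ, B ^ τ * (e * ∫⁻ y in dyadicCube 0 m, E y) :=
            ENNReal.tsum_le_tsum hcube
        _ = B ^ τ * (e * ∫⁻ x in ⋃ m : Fin n → ℤ, dyadicCube 0 m, E x) := by
            rw [ENNReal.tsum_mul_left, ENNReal.tsum_mul_left,
              lintegral_iUnion measurableSet_dyadicCube_zero pairwise_disjoint_dyadicCube_zero]
        _ = _ := by rw [← hae]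
    rw [eLpNorm_eq_lintegral_rpow_enorm_toReal hθ.ne' ht]
    calc (∫⁻ x, ‖H x * ENNReal.ofReal (Real.exp (-‖x‖))‖ₑ ^ τ) ^ (1 / τ)
        = (∫⁻ x, H x ^ τ * E x) ^ (1 / τ) := by
          congr 2; funext x
          rw [enorm_eq_self, ENNReal.mul_rpow_of_nonneg _ _ hτ.le,
            ENNReal.ofReal_rpow_of_nonneg (Real.exp_nonneg _) hτ.le, ← Real.exp_mul]
          congr 3; ring
      _ ≤ (B ^ τ * (e * ∫⁻ x, E x)) ^ (1 / τ) := by gcongr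
      _ = _ := by
          rw [ENNReal.mul_rpow_of_nonneg _ _ (by positivity), ← ENNReal.rpow_mul,
            mul_one_div_cancel hτ.ne', ENNReal.rpow_one, mul_comm]

end UnitCubes

/-! ### From weighted L_p norms to exponentially weighted L_θ norms -/

section Weights

open Filter Topology

variable {n : ℕ}

/-- This is 1/θ = 1/σ₁ + 1/p. The case θ = p, possibly infinite, is separate: there σ₁ = ∞ by the
convention s_s = 1. -/
theorem holderTriple_expQuotConj {p θ : ℝ≥0∞} (hθ : 0 < θ) (hθp : θ ≤ p) :
    ENNReal.HolderTriple (θ * expQuotConj p θ) p θ := by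
  constructor
  rw [expQuotConj, expQuot]
  split_ifs with h
  · subst h
    have : ENNReal.conjExponent 1 = ∞ := by simp [ENNReal.conjExponent]
    simp [this, ENNReal.mul_top hθ.ne']
  · have hlt : θ < p := lt_of_le_of_ne hθp (Ne.symm h)
    have hθt : θ ≠ ∞ := hlt.ne_top
    have h1 : 1 ≤ p / θ := by
      rw [ENNReal.le_div_iff_mul_le (Or.inl hθ.ne') (Or.inl hθt), one_mul]; exact hθp
    have h2 := (ENNReal.HolderConjugate.conjExponent h1).inv_add_inv_eq_one
    rw [ENNReal.mul_inv (Or.inl hθ.ne') (Or.inl hθt)]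
    have h3 : p⁻¹ = θ⁻¹ * (p / θ)⁻¹ := by
      rw [ENNReal.inv_div (Or.inl hθt) (Or.inl hθ.ne'), div_eq_mul_inv, ← mul_assoc,
        ENNReal.inv_mul_cancel hθ.ne' hθt, one_mul]
    rw [h3, ← mul_add, add_comm, h2, mul_one]

theorem IsXClass.cubeNorm_zero_le {p σ₁ σ₂ : ℝ≥0∞} {α₁ α₂ : ℕ → ℝ} {α₃ : ℝ}
    {t : ℕ → Rn n → ℝ} (ht : IsXClass p σ₁ σ₂ α₁ α₂ α₃ t) (M : ℕ) (m : Fin n → ℤ)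
    (hm : ∀ i, |m i| ≤ M) :
    cubeNorm t p 0 0 ≤ ENNReal.ofReal ((2 : ℝ) ^ α₃) ^ M * cubeNorm t p 0 m := by
  induction M generalizing m with
  | zero =>
    have : m = 0 := funext fun i => by simpa using hm i
    simp [this]
  | succ M ih =>
    -- All coordinates move one step towards 0 at once, so the number of steps is the maximum norm
    -- of m.
    set m' : Fin n → ℤ := fun i => m i - (m i).sign with hm'
    have h1 : ∀ i, |m' i| ≤ M := fun i => by
      have := hm i
      push_cast at this
      rcases lt_trichotomy (m i) 0 with h | h | h
      · simp only [hm', Int.sign_eq_neg_one_of_neg h]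
        rw [abs_le] at this ⊢; omega
      · simp [hm', h]
      · simp only [hm', Int.sign_eq_one_of_pos h]
        rw [abs_le] at this ⊢; omega
    have h2 : ∀ i, |m' i - m i| ≤ 1 := fun i => by
      rcases lt_trichotomy (m i) 0 with h | h | h
      · simp [hm', Int.sign_eq_neg_one_of_neg h]
      · simp [hm', h]
      · simp [hm', Int.sign_eq_one_of_pos h]
    refine (ih m' h1).trans ?_
    rw [pow_succ, mul_assoc]
    exact mul_le_mul' le_rfl (ht.neighbour 0 m' m h2).2

/-- On the weight class `X`, the `L_θ` norm of `g` with a suitable exponential weight is controlled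
by `‖t_j g | L_p‖ / α_j`. -/
theorem IsXClass.exists_eLpNorm_le {𝕜 : Type*} [RCLike 𝕜] {p θ σ₂ : ℝ≥0∞} (hθ : 0 < θ)
    (hθp : θ ≤ p) {α₁ α₂ : ℕ → ℝ} (hα₁ : ∀ k, 0 < α₁ k) {α₃ : ℝ} (hα₃ : 0 ≤ α₃)
    {t : ℕ → Rn n → ℝ} (ht : IsXClass p (θ * expQuotConj p θ) σ₂ α₁ α₂ α₃ t) :
    ∃ R₀ : ℝ, ∀ R, R₀ ≤ R → ∃ C : ℝ≥0∞, C ≠ ∞ ∧ ∀ (j : ℕ) (g : Rn n → 𝕜), Continuous g →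
      eLpNorm (fun x => ‖g x‖ₑ * ENNReal.ofReal (Real.exp (-R * ‖x‖))) θ volume
        ≤ C * (ENNReal.ofReal (α₁ j)⁻¹ * eLpNorm (fun x => t j x • g x) p volume) := by
  obtain ⟨C₁, hC₁, hlow⟩ := ht.lower
  obtain ⟨C, hC, hCθ⟩ := exists_eLpNorm_mul_exp_le (n := n) hθ
  have hHolder := holderTriple_expQuotConj hθ hθp
  set σ := θ * expQuotConj p θ
  set b := α₃ * Real.log 2 with hb
  have hb0 : 0 ≤ b := mul_nonneg hα₃ (Real.log_nonneg one_le_two)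
  have h2b : (2 : ℝ) ^ α₃ = Real.exp b := by
    rw [Real.rpow_def_of_pos two_pos, hb, mul_comm]
  have hN0 : 0 < cubeNorm t p 0 (0 : Fin n → ℤ) := (ht.neighbour 0 0 0 (by simp)).1
  set D := ENNReal.ofReal (Real.exp b) * ENNReal.ofReal (C₁ * α₁ 0) / cubeNorm t p 0 (0 : Fin n → ℤ)
  have hD : D ≠ ∞ := ENNReal.div_ne_top (by finiteness) hN0.ne'
  -- Of the rate b + 1, the part b = α₃ log 2 compensates the decay of ‖t_0‖ over the cubes, and 1
  -- makes the cubes summable.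
  refine ⟨b + 1, fun R hR => ⟨C * D, by finiteness, fun j g hg => ?_⟩⟩
  have hmono : eLpNorm (fun x => ‖g x‖ₑ * ENNReal.ofReal (Real.exp (-R * ‖x‖))) θ volume
      ≤ eLpNorm (fun x => ‖g x‖ₑ * ENNReal.ofReal (Real.exp (-b * ‖x‖))
        * ENNReal.ofReal (Real.exp (-‖x‖))) θ volume := by
    refine eLpNorm_mono_enorm fun x => ?_
    rw [enorm_eq_self, enorm_eq_self, mul_assoc, ← ENNReal.ofReal_mul (Real.exp_nonneg _),
      ← Real.exp_add]
    gcongr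
    nlinarith [norm_nonneg x]
  refine hmono.trans ?_
  rw [mul_assoc]
  refine hCθ _ _ fun m => ?_
  set Q := dyadicCube 0 m
  set M := Finset.univ.sup fun i => (m i).natAbs
  have hM : ∀ i, |m i| ≤ M := fun i => by
    rw [Int.abs_eq_natAbs]
    exact_mod_cast Finset.le_sup (f := fun i => (m i).natAbs) (Finset.mem_univ i)
  -- Hence exp(-b|x|) ≤ exp(b) exp(-Mb) on Q, which cancels the factor exp(Mb) from M neighbour
  -- steps.
  have hMx : ∀ x ∈ Q, (M : ℝ) ≤ ‖x‖ + 1 := by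
    intro x hx
    have h1 : ∀ i, ((m i).natAbs : ℝ) ≤ ‖x‖ + 1 := fun i => by
      have h2 := mem_dyadicCube_zero.mp hx i
      have h3 : ‖x i‖ ≤ ‖x‖ := PiLp.norm_apply_le x i
      rw [Real.norm_eq_abs, abs_le] at h3
      rw [Nat.cast_natAbs, Int.cast_abs, abs_le]
      constructor <;> linarith
    have h0 : (0 : ℝ) ≤ ‖x‖ + 1 := by positivity
    have h2 : M ≤ ⌊‖x‖ + 1⌋₊ := Finset.sup_le fun i _ => Nat.le_floor (h1 i)
    exact (Nat.cast_le.mpr h2).trans (Nat.floor_le h0)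
  have hNm := ht.cubeNorm_zero_le M m hM
  rw [h2b, ← ENNReal.ofReal_pow (Real.exp_nonneg _), ← Real.exp_nat_mul] at hNm
  have hpos := ht.admissible.pos j
  have hmeas := ht.admissible.aemeasurable j
  -- Hölder for g = t_j⁻¹ · (t_j g), valid almost everywhere since t_j > 0 there.
  have hgQ : eLpNorm g θ (volume.restrict Q)
      ≤ eLpNorm (fun x => (t j x)⁻¹) σ (volume.restrict Q)
        * eLpNorm (fun x => t j x • g x) p volume := by
    have e1 : eLpNorm g θ (volume.restrict Q)
        = eLpNorm ((fun x => (t j x)⁻¹) • fun x => t j x • g x) θ (volume.restrict Q) := by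
      refine eLpNorm_congr_ae (ae_restrict_of_ae ?_)
      filter_upwards [hpos] with x hx
      simp [smul_smul, inv_mul_cancel₀ hx.ne']
    rw [e1]
    refine (eLpNorm_smul_le_mul_eLpNorm (p := σ) (q := p) ?_ ?_).trans ?_
    · exact (hmeas.aestronglyMeasurable.smul hg.aestronglyMeasurable).restrict
    · exact hmeas.inv.aestronglyMeasurable.restrict
    · exact mul_le_mul' le_rfl (eLpNorm_restrict_le _ _ _ _)
  have hmean := hlow 0 j (Nat.zero_le j) m
  simp only [cubeMean, zero_mul, pow_zero, one_smul] at hmean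
  change cubeNorm t p 0 m * eLpNorm (fun x => (t j x)⁻¹) σ (volume.restrict Q) ≤ _ at hmean
  have hwt : eLpNorm (fun x => ‖g x‖ₑ * ENNReal.ofReal (Real.exp (-b * ‖x‖))) θ
      (volume.restrict Q)
      ≤ ENNReal.ofReal (Real.exp b * Real.exp (-(M * b))) * eLpNorm g θ (volume.restrict Q) := by
    refine eLpNorm_le_mul_eLpNorm_of_ae_le_mul'' θ hg.aestronglyMeasurable.restrict
      ((ae_restrict_iff' (measurableSet_dyadicCube_zero m)).mpr (.of_forall fun x hx => ?_))
    rw [enorm_eq_self, mul_comm]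
    gcongr
    rw [← Real.exp_add]
    refine Real.exp_le_exp.mpr ?_
    nlinarith [hMx x hx]
  refine hwt.trans ?_
  set τ := eLpNorm (fun x => (t j x)⁻¹) σ (volume.restrict Q)
  set a := eLpNorm (fun x => t j x • g x) p volume
  have key : ENNReal.ofReal (Real.exp b * Real.exp (-(M * b))) * τ
      ≤ D * ENNReal.ofReal (α₁ j)⁻¹ := by
    have h3 : cubeNorm t p 0 (0 : Fin n → ℤ) * (ENNReal.ofReal (Real.exp (-(M * b))) * τ)
        ≤ ENNReal.ofReal (C₁ * α₁ 0) * ENNReal.ofReal (α₁ j)⁻¹ := by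
      calc _ ≤ ENNReal.ofReal (Real.exp (M * b)) * cubeNorm t p 0 m
            * (ENNReal.ofReal (Real.exp (-(M * b))) * τ) := by gcongr
        _ = (ENNReal.ofReal (Real.exp (M * b)) * ENNReal.ofReal (Real.exp (-(M * b))))
            * (cubeNorm t p 0 m * τ) := by ring
        _ = cubeNorm t p 0 m * τ := by
            rw [← ENNReal.ofReal_mul (Real.exp_nonneg _), ← Real.exp_add]; simp
        _ ≤ _ := hmean
        _ = _ := by
            rw [← ENNReal.ofReal_mul (mul_nonneg hC₁.le (hα₁ 0).le)]
            congr 1; ring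
    have h4 : ENNReal.ofReal (Real.exp (-(M * b))) * τ
        ≤ ENNReal.ofReal (C₁ * α₁ 0) * ENNReal.ofReal (α₁ j)⁻¹ / cubeNorm t p 0 (0 : Fin n → ℤ) := by
      rw [ENNReal.le_div_iff_mul_le (Or.inl hN0.ne') (Or.inr (by finiteness)), mul_comm]
      exact h3
    rw [ENNReal.ofReal_mul (Real.exp_nonneg _), mul_assoc]
    refine (mul_le_mul' le_rfl h4).trans (le_of_eq ?_)
    simp only [D, div_eq_mul_inv]
    ring
  calc _ ≤ ENNReal.ofReal (Real.exp b * Real.exp (-(M * b))) * (τ * a) := by gcongr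
    _ = ENNReal.ofReal (Real.exp b * Real.exp (-(M * b))) * τ * a := by ring
    _ ≤ D * ENNReal.ofReal (α₁ j)⁻¹ * a := by gcongr
    _ = _ := by ring

end Weights

/-! ### Sequence spaces -/

section Sequences

/-- The inclusion of l_μ in l_1: b_k = b_k^{1-μ} b_k^μ, and the first factor is bounded. -/
theorem tsum_lt_top_of_tsum_rpow_lt_top {b : ℕ → ℝ≥0∞} {μ : ℝ} (hμ : 0 < μ) (hμ1 : μ ≤ 1)
    (h : ∑' k, b k ^ μ < ∞) : ∑' k, b k < ∞ := by
  set S := ∑' k, b k ^ μ with hS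
  have hb : ∀ k, b k ≤ S ^ (1 / μ) := fun k => by
    calc b k = (b k ^ μ) ^ (1 / μ) := by
          rw [← ENNReal.rpow_mul, mul_one_div_cancel hμ.ne', ENNReal.rpow_one]
      _ ≤ _ := by gcongr; exact ENNReal.le_tsum k
  have hle : ∀ k, b k ≤ (S ^ (1 / μ)) ^ (1 - μ) * b k ^ μ := fun k => by
    calc b k = b k ^ (1 - μ) * b k ^ μ := by
          rw [← ENNReal.rpow_add_of_nonneg _ _ (by linarith) hμ.le, sub_add_cancel,
            ENNReal.rpow_one]
      _ ≤ _ := mul_le_mul' (ENNReal.rpow_le_rpow (hb k) (by linarith)) le_rfl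
  have hfin : S ^ (1 / μ) ≠ ∞ := ENNReal.rpow_ne_top_of_nonneg (by positivity) h.ne
  refine (ENNReal.tsum_le_tsum hle).trans_lt ?_
  rw [ENNReal.tsum_mul_left]
  exact ENNReal.mul_lt_top (ENNReal.rpow_lt_top_of_nonneg (by linarith) hfin) h

theorem tsum_mul_lt_top_of_holderConjugate {p q : ℝ} (hpq : p.HolderConjugate q) {a u : ℕ → ℝ≥0∞}
    (ha : ∑' k, a k ^ p < ∞) (hu : ∑' k, u k ^ q < ∞) : ∑' k, a k * u k < ∞ := by
  have h := ENNReal.lintegral_mul_le_Lp_mul_Lq (Measure.count : Measure ℕ) hpq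
    (f := a) (g := u) (measurable_of_countable _).aemeasurable (measurable_of_countable _).aemeasurable
  simp only [lintegral_count, Pi.mul_apply] at h
  refine h.trans_lt (ENNReal.mul_lt_top ?_ ?_)
  · exact ENNReal.rpow_lt_top_of_nonneg (one_div_nonneg.mpr hpq.nonneg) ha.ne
  · exact ENNReal.rpow_lt_top_of_nonneg (one_div_nonneg.mpr hpq.symm.nonneg) hu.ne

theorem tsum_ofReal_rpow_lt_top {u : ℕ → ℝ} (hu : ∀ k, 0 ≤ u k) {s : ℝ≥0∞} (hs : 0 < s.toReal)
    (h : Memℓp u s) : ∑' k, ENNReal.ofReal (u k) ^ s.toReal < ∞ := by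
  have h1 := (memℓp_gen_iff hs).mp h
  have h2 : ∀ k, ENNReal.ofReal (u k) ^ s.toReal = ENNReal.ofReal (‖u k‖ ^ s.toReal) := fun k => by
    rw [ENNReal.ofReal_rpow_of_nonneg (hu k) hs.le, Real.norm_of_nonneg (hu k)]
  simp_rw [h2]
  exact h1.tsum_ofReal_lt_top

/-- If `a ∈ l_q` and `u ∈ l_{q'_μ}`, then `∑ₖ a_k^μ u_k < ∞`. -/
theorem tsum_rpow_mul_lt_top {q : ℝ≥0∞} {μ : ℝ} (hμ : 0 < μ) (hμq : ENNReal.ofReal μ ≤ q)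
    {a : ℕ → ℝ≥0∞} (ha : lqNorm q a < ∞) {u : ℕ → ℝ} (hu : ∀ k, 0 ≤ u k)
    (hu' : Memℓp u (expQuotConj q (ENNReal.ofReal μ))) :
    ∑' k, a k ^ μ * ENNReal.ofReal (u k) < ∞ := by
  have hμ0 : ENNReal.ofReal μ ≠ 0 := by simpa using hμ
  have hq0 : 0 < q := (pos_iff_ne_zero.mpr hμ0).trans_le hμq
  have haq : q ≠ ∞ → ∑' k, a k ^ q.toReal < ∞ := fun hq => by
    rw [lqNorm, if_neg hq] at ha
    by_contra hinf
    rw [not_lt, top_le_iff] at hinf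
    rw [hinf, ENNReal.top_rpow_of_pos (one_div_pos.mpr (ENNReal.toReal_pos hq0.ne' hq))] at ha
    exact lt_irrefl _ ha
  rw [expQuotConj, expQuot] at hu'
  -- Three cases: q = μ pairs l_1 with l_∞, q = ∞ pairs l_∞ with l_1, and otherwise real Hölder
  -- applies with exponent q/μ > 1.
  split_ifs at hu' with h
  · subst h
    have hc : ENNReal.conjExponent 1 = ∞ := by simp [ENNReal.conjExponent]
    rw [hc, memℓp_infty_iff] at hu'
    obtain ⟨K, hK⟩ := hu'
    have h1 := haq ENNReal.ofReal_ne_top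
    rw [ENNReal.toReal_ofReal hμ.le] at h1
    refine lt_of_le_of_lt (ENNReal.tsum_le_tsum fun k => mul_le_mul' le_rfl
      (ENNReal.ofReal_le_ofReal ((le_abs_self _).trans (hK ⟨k, rfl⟩)))) ?_
    rw [ENNReal.tsum_mul_right]
    exact ENNReal.mul_lt_top h1 ENNReal.ofReal_lt_top
  · rcases eq_or_ne q ∞ with rfl | hq
    · have hc : ENNReal.conjExponent (∞ / ENNReal.ofReal μ) = 1 := by
        rw [ENNReal.top_div_of_ne_top ENNReal.ofReal_ne_top]
        simp [ENNReal.conjExponent]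
      rw [hc] at hu'
      have h1 := tsum_ofReal_rpow_lt_top hu (by simp) hu'
      simp only [ENNReal.toReal_one, ENNReal.rpow_one] at h1
      rw [lqNorm, if_pos rfl] at ha
      refine lt_of_le_of_lt (ENNReal.tsum_le_tsum fun k => mul_le_mul'
        (ENNReal.rpow_le_rpow (le_iSup a k) hμ.le) le_rfl) ?_
      rw [ENNReal.tsum_mul_left]
      exact ENNReal.mul_lt_top (ENNReal.rpow_lt_top_of_nonneg hμ.le ha.ne) h1
    · have hlt : ENNReal.ofReal μ < q := lt_of_le_of_ne hμq (Ne.symm h)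
      have hμq' : μ < q.toReal := by
        rwa [ENNReal.ofReal_lt_iff_lt_toReal hμ.le hq] at hlt
      have hQ : (q / ENNReal.ofReal μ).toReal = q.toReal / μ := by
        rw [ENNReal.toReal_div, ENNReal.toReal_ofReal hμ.le]
      have hQ1 : 1 < (q / ENNReal.ofReal μ).toReal := by
        rw [hQ, one_lt_div hμ]; exact hμq'
      have hQle : 1 ≤ q / ENNReal.ofReal μ := by
        rw [ENNReal.le_div_iff_mul_le (Or.inl hμ0) (Or.inl ENNReal.ofReal_ne_top), one_mul]
        exact hμq
      have hconj := ENNReal.HolderConjugate.conjExponent hQle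
      have hreal := ENNReal.HolderConjugate.toReal hQ1
        (q := ENNReal.conjExponent (q / ENNReal.ofReal μ))
      refine tsum_mul_lt_top_of_holderConjugate hreal ?_
        (tsum_ofReal_rpow_lt_top hu hreal.symm.pos hu')
      have h2 : ∀ k, (a k ^ μ) ^ (q / ENNReal.ofReal μ).toReal = a k ^ q.toReal := fun k => by
        rw [← ENNReal.rpow_mul, hQ, mul_div_cancel₀ _ hμ.ne']
      simp_rw [h2]
      exact haq hq

end Sequences

/-! ### Convergence of the series in L_r^loc and identification of the limit -/

section Assembly

open Filter Topology

variable {𝕜 : Type*} [RCLike 𝕜] {n : ℕ}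

theorem exists_eLpNorm_restrict_le_wconv (φ₀ : Test 𝕜 n) {f : Distr 𝕜 n} (hf : IsExpDistr f)
    (R : ℝ) (r : ℝ≥0∞) {K : Set (Rn n)} (hK : IsCompact K) :
    ∃ C : ℝ≥0∞, C ≠ ∞ ∧ ∀ k, eLpNorm (conv (phiSeq φ₀ k) f) r (volume.restrict K)
      ≤ C * eLpNorm (wconv φ₀ f R k) r volume := by
  have hc : Continuous fun x : Rn n => Real.exp (R * ‖x‖) := by fun_prop
  obtain ⟨B, hB⟩ := hK.bddAbove_image hc.continuousOn
  refine ⟨ENNReal.ofReal B, ENNReal.ofReal_ne_top, fun k => ?_⟩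
  refine (eLpNorm_le_mul_eLpNorm_of_ae_le_mul'' (g := wconv φ₀ f R k) r
    (hf.continuous_wconv φ₀ R k).aestronglyMeasurable.restrict
    ((ae_restrict_iff' hK.measurableSet).mpr (.of_forall fun x hx => ?_))).trans
    (mul_le_mul' le_rfl (eLpNorm_restrict_le _ _ _ _))
  rw [enorm_eq_self, wconv, mul_left_comm]
  refine le_mul_of_one_le_right zero_le ?_
  rw [← ENNReal.ofReal_mul' (Real.exp_nonneg _), ENNReal.one_le_ofReal]
  calc (1 : ℝ) = Real.exp (R * ‖x‖) * Real.exp (-R * ‖x‖) := by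
        rw [← Real.exp_add]; simp
    _ ≤ _ := by
        gcongr
        exact hB ⟨x, hx, rfl⟩

/-- The sum of a sequence of functions with summable `L_r` norms over compact sets is locally
in `L_r`. -/
theorem memLpLoc_tsum {F : ℕ → Rn n → 𝕜} (hF : ∀ k, Continuous (F k)) {r : ℝ≥0∞} (hr : 1 ≤ r)
    (h : ∀ K : Set (Rn n), IsCompact K → ∑' k, eLpNorm (F k) r (volume.restrict K) < ∞) :
    MemLpLoc (fun x => ∑' k, F k x) r := by
  intro K hK
  have : IsFiniteMeasure (volume.restrict K) := ⟨by simpa using hK.measure_lt_top⟩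
  set ν := volume.restrict K
  have hm : ∀ k, AEStronglyMeasurable (F k) ν := fun k => (hF k).aestronglyMeasurable
  -- Since K has finite measure, the L_1 norms are summable as well, which gives absolute
  -- convergence almost everywhere; Fatou then returns to L_r.
  have h1 : ∑' k, eLpNorm (F k) 1 ν < ∞ := by
    refine lt_of_le_of_lt (ENNReal.tsum_le_tsum fun k =>
      eLpNorm_le_eLpNorm_mul_rpow_measure_univ hr (hm k)) ?_
    rw [ENNReal.tsum_mul_right]
    refine ENNReal.mul_lt_top (h K hK) (ENNReal.rpow_lt_top_of_nonneg ?_ (measure_ne_top _ _))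
    have h3 : (r⁻¹).toReal ≤ 1 := by
      simpa using ENNReal.toReal_mono (by simp) (ENNReal.inv_le_one.mpr hr)
    rw [ENNReal.toReal_one, one_div_one, one_div, ← ENNReal.toReal_inv]
    linarith
  have h2 : ∀ᵐ x ∂ν, Summable fun k => F k x := by
    simp_rw [eLpNorm_one_eq_lintegral_enorm] at h1
    rw [← lintegral_tsum fun k => (hm k).enorm] at h1
    filter_upwards [ae_lt_top' (AEMeasurable.tsum fun k => (hm k).enorm) h1.ne] with x hx
    exact .of_enorm hx.ne
  have h3 : ∀ᵐ x ∂ν, Tendsto (fun N => (∑ k ∈ Finset.range N, F k) x) atTop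
      (𝓝 (∑' k, F k x)) := by
    filter_upwards [h2] with x hx
    simpa using hx.hasSum.tendsto_sum_nat
  have hms : ∀ N, AEStronglyMeasurable (∑ k ∈ Finset.range N, F k) ν := fun N =>
    Finset.aestronglyMeasurable_sum _ fun k _ => hm k
  refine ⟨aestronglyMeasurable_of_tendsto_ae _ hms h3, ?_⟩
  refine (Lp.eLpNorm_lim_le_liminf_eLpNorm hms _ h3).trans_lt (lt_of_le_of_lt ?_ (h K hK))
  refine (liminf_le_liminf (v := fun _ => ∑' k, eLpNorm (F k) r ν)
    (.of_forall fun N => ?_)).trans (le_of_eq (liminf_const _))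
  exact (eLpNorm_sum_le (fun k _ => hm k) hr).trans (ENNReal.sum_le_tsum _)

theorem IsExpDistr.mem_lpLocDistr {f : Distr 𝕜 n} (hf : IsExpDistr f) {φ₀ : Test 𝕜 n}
    (h1 : ∫ x, φ₀ x = 1) {r : ℝ≥0∞} (hr : 1 ≤ r)
    (h : ∀ K : Set (Rn n), IsCompact K →
      ∑' k, eLpNorm (conv (phiSeq φ₀ k) f) r (volume.restrict K) < ∞) :
    f ∈ lpLocDistr 𝕜 n r := by
  have hcont : ∀ k, Continuous (conv (phiSeq φ₀ k) f) := fun k => hf.continuous_conv _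
  refine ⟨fun x => ∑' k, conv (phiSeq φ₀ k) f x, memLpLoc_tsum hcont hr h, fun ψ => ?_⟩
  set K := tsupport ψ
  have hK : IsCompact K := ψ.hasCompactSupport.isCompact
  have : IsFiniteMeasure (volume.restrict K) := ⟨by simpa using hK.measure_lt_top⟩
  have hint : ∀ k, Integrable (fun x => conv (phiSeq φ₀ k) f x * ψ x) volume := fun k =>
    Continuous.integrable_of_hasCompactSupport ((hcont k).mul ψ.continuous)
      ψ.hasCompactSupport.mul_left
  have hb : ∀ k, ∫⁻ x, ‖conv (phiSeq φ₀ k) f x * ψ x‖ₑ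
      ≤ eLpNorm (conv (phiSeq φ₀ k) f) r (volume.restrict K)
        * (volume.restrict K Set.univ ^ (1 - (r⁻¹).toReal) * ENNReal.ofReal (ψ.pnorm 0)) := by
    intro k
    have e1 : eLpNorm (conv (phiSeq φ₀ k) f) 1 (volume.restrict K)
        ≤ eLpNorm (conv (phiSeq φ₀ k) f) r (volume.restrict K)
          * volume.restrict K Set.univ ^ (1 - (r⁻¹).toReal) := by
      have := eLpNorm_le_eLpNorm_mul_rpow_measure_univ hr
        ((hcont k).aestronglyMeasurable (μ := volume.restrict K))
      rwa [ENNReal.toReal_one, one_div_one, one_div, ← ENNReal.toReal_inv] at this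
    rw [← mul_assoc]
    refine le_trans ?_ (mul_le_mul' e1 le_rfl)
    rw [eLpNorm_one_eq_lintegral_enorm, ← lintegral_mul_const' _ _ ENNReal.ofReal_ne_top,
      ← lintegral_indicator hK.measurableSet]
    refine lintegral_mono fun x => ?_
    by_cases hx : x ∈ K
    · rw [Set.indicator_of_mem hx, enorm_mul]
      gcongr
      rw [← ofReal_norm]
      exact ENNReal.ofReal_le_ofReal (ψ.norm_le_pnorm x)
    · simp [image_eq_zero_of_notMem_tsupport hx]
  have hr1 : (r⁻¹).toReal ≤ 1 := by
    simpa using ENNReal.toReal_mono (by simp) (ENNReal.inv_le_one.mpr hr)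
  have hfin : ∑' k, ∫⁻ x, ‖conv (phiSeq φ₀ k) f x * ψ x‖ₑ ≠ ∞ := by
    refine ne_top_of_le_ne_top ?_ (ENNReal.tsum_le_tsum hb)
    rw [ENNReal.tsum_mul_right]
    exact ENNReal.mul_ne_top (h K hK).ne (ENNReal.mul_ne_top
      (ENNReal.rpow_ne_top_of_nonneg (by linarith) (measure_ne_top _ _)) ENNReal.ofReal_ne_top)
  have hsum : Summable fun k => ∫ x, ‖conv (phiSeq φ₀ k) f x * ψ x‖ := by
    have := ENNReal.summable_toReal hfin
    refine this.congr fun k => ?_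
    rw [integral_norm_eq_lintegral_enorm (hint k).aestronglyMeasurable]
  have hs := (hasSum_integral_of_summable_integral_norm hint hsum).tendsto_sum_nat
  have hlim := hf.tendsto_integral_conv_dyadic h1 ψ
  -- Both limits concern the same partial sums: one is f ψ, the other the integral of the sum of the
  -- series.
  have heq : ∀ N, ∫ x, conv (Test.dyadic N φ₀) f x * ψ x
      = ∑ k ∈ Finset.range (N + 1), ∫ x, conv (phiSeq φ₀ k) f x * ψ x := by
    intro N
    rw [← integral_finsetSum _ fun k _ => hint k]
    refine integral_congr_ae (.of_forall fun x => ?_)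
    simp only
    rw [← sum_phiSeq, conv_sum, Finset.sum_mul]
  simp_rw [heq] at hlim
  rw [tendsto_nhds_unique hlim ((tendsto_add_atTop_iff_nat 1).mpr hs)]
  refine integral_congr_ae (.of_forall fun x => ?_)
  exact tsum_mul_right

end Assembly

end VarBesov

end

theorem theorem4p1 {𝕜 : Type*} [RCLike 𝕜] {n : ℕ} (hn : 1 ≤ n)
    {p q r θ σ₂ : ℝ≥0∞} (hp : 0 < p) (hq : 0 < q) (hr : 1 ≤ r)
    (hθ₀ : 0 < θ) (hθ : θ ≤ min p r) (hσ₂ : 0 < σ₂)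
    {α₁ α₂ : ℕ → ℝ} (hα₁ : ∀ k, 0 < α₁ k) (hα₂ : ∀ k, 0 < α₂ k)
    {α₃ : ℝ} (hα₃ : 0 ≤ α₃)
    (hμ : ∃ μ : ℝ, 0 < μ ∧ ENNReal.ofReal μ ≤ min 1 (min q θ) ∧
      Memℓp (fun k : ℕ =>
          (2 : ℝ) ^ ((k : ℝ) * n * μ * ((θ⁻¹).toReal - (r⁻¹).toReal)) * α₁ k ^ (-μ))
        (VarBesov.expQuotConj q (ENNReal.ofReal μ)))
    {t : ℕ → VarBesov.Rn n → ℝ}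
    (ht : VarBesov.IsXClass p (θ * VarBesov.expQuotConj p θ) σ₂ α₁ α₂ α₃ t)
    (φ₀ : VarBesov.Test 𝕜 n) (hφ₀ : ∫ x, φ₀ x = 1) :
    VarBesov.besovSpace φ₀ p q t ⊆ VarBesov.lpLocDistr 𝕜 n r := by
  rintro f ⟨hf, hnorm⟩
  obtain ⟨μ, hμ0, hμle, hmem⟩ := hμ
  have hθp : θ ≤ p := hθ.trans (min_le_left _ _)
  have hθr : θ ≤ r := hθ.trans (min_le_right _ _)
  have hμ1 : μ ≤ 1 := by
    rw [← ENNReal.ofReal_le_one]; exact hμle.trans (min_le_left _ _)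
  have hμq : ENNReal.ofReal μ ≤ q := hμle.trans ((min_le_right _ _).trans (min_le_left _ _))
  obtain ⟨N, hN⟩ := hf.exists_eLpNorm_wconv_le hφ₀ hθ₀ hθr hr
  obtain ⟨R₀, hR₀⟩ := ht.exists_eLpNorm_le (𝕜 := 𝕜) hθ₀ hθp hα₁ hα₃
  -- One rate has to serve both the growth of f and the decay of the weights, which is why both
  -- estimates hold for all large R.
  set R : ℝ := max N R₀
  obtain ⟨C, hC, hCk⟩ := hN R (le_max_left _ _)
  obtain ⟨D, hD, hDj⟩ := hR₀ R (le_max_right _ _)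
  set e := (θ⁻¹).toReal - (r⁻¹).toReal with he
  set a : ℕ → ℝ≥0∞ := fun j =>
    eLpNorm (fun x => t j x • VarBesov.conv (VarBesov.phiSeq φ₀ j) f x) p volume with ha
  set w : ℕ → ℝ≥0∞ := fun j => (2 ^ (j * n)) ^ e * ENNReal.ofReal (α₁ j)⁻¹ with hw
  -- The μ-th power of w is exactly the sequence assumed to lie in l_{q'_μ}.
  have hwu : ∀ j : ℕ, w j ^ μ
      = ENNReal.ofReal ((2 : ℝ) ^ ((j : ℝ) * n * μ * e) * α₁ j ^ (-μ)) := by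
    intro j
    have h2 : (2 : ℝ≥0∞) ^ (j * n) = ENNReal.ofReal ((2 : ℝ) ^ ((j : ℝ) * n)) := by
      rw [← Nat.cast_mul, Real.rpow_natCast, ENNReal.ofReal_pow zero_le_two, ENNReal.ofReal_ofNat]
    have h3 : (0 : ℝ) < 2 ^ ((j : ℝ) * n) := Real.rpow_pos_of_pos two_pos _
    have h4 := inv_pos.mpr (hα₁ j)
    simp only [hw]
    rw [h2, ENNReal.ofReal_rpow_of_pos h3, ← ENNReal.ofReal_mul (by positivity),
      ENNReal.ofReal_rpow_of_pos (by positivity), Real.mul_rpow (by positivity) h4.le,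
      ← Real.rpow_mul two_pos.le, ← Real.rpow_mul two_pos.le, Real.inv_rpow (hα₁ j).le,
      Real.rpow_neg (hα₁ j).le]
    congr 3; ring
  have hfin : ∑' j, w j * a j < ∞ := by
    refine VarBesov.tsum_lt_top_of_tsum_rpow_lt_top hμ0 hμ1 ?_
    have := VarBesov.tsum_rpow_mul_lt_top hμ0 hμq hnorm
      (fun k => mul_nonneg (Real.rpow_nonneg two_pos.le _) (Real.rpow_nonneg (hα₁ k).le _)) hmem
    refine lt_of_eq_of_lt (tsum_congr fun j => ?_) this
    rw [ENNReal.mul_rpow_of_nonneg _ _ hμ0.le, hwu, mul_comm]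
  have hsum : ∑' k, eLpNorm (VarBesov.wconv φ₀ f R k) r volume < ∞ := by
    have hU : ∀ j, (2 ^ (j * n)) ^ e * eLpNorm (VarBesov.wconv φ₀ f R j) θ volume
        ≤ D * (w j * a j) := by
      intro j
      calc _ ≤ (2 ^ (j * n)) ^ e * (D * (ENNReal.ofReal (α₁ j)⁻¹ * a j)) :=
            mul_le_mul' le_rfl (hDj j _ (hf.continuous_conv _))
        _ = _ := by simp only [hw]; ring
    calc ∑' k, eLpNorm (VarBesov.wconv φ₀ f R k) r volume
        ≤ ∑' k, C * ∑' d : ℕ, 2⁻¹ ^ d * (D * (w (k + d) * a (k + d))) := by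
          refine ENNReal.tsum_le_tsum fun k => (hCk k).trans ?_
          exact mul_le_mul' le_rfl (ENNReal.tsum_le_tsum fun d => mul_le_mul' le_rfl (hU _))
      _ ≤ C * (2 * ∑' j, D * (w j * a j)) := by
          rw [ENNReal.tsum_mul_left]
          exact mul_le_mul' le_rfl
            (VarBesov.tsum_tsum_two_inv_pow_mul_le fun j => D * (w j * a j))
      _ < ∞ := by
          rw [ENNReal.tsum_mul_left]
          exact ENNReal.mul_lt_top hC.lt_top (ENNReal.mul_lt_top (by simp)
            (ENNReal.mul_lt_top hD.lt_top hfin))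
  refine hf.mem_lpLocDistr hφ₀ hr fun K hK => ?_
  obtain ⟨B, hB, hBk⟩ := VarBesov.exists_eLpNorm_restrict_le_wconv φ₀ hf R r hK
  refine lt_of_le_of_lt (ENNReal.tsum_le_tsum hBk) ?_
  rw [ENNReal.tsum_mul_left]
  exact ENNReal.mul_lt_top hB.lt_top hsum
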